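/- Let $k$ be a field. By an algebraic group over $k$ we mean a group scheme of finite type over $k$. Let $(G,\cdot,e)$ be a connected, smooth algebraic group over $k$, let $(A,+,0)$ be an algebraic group over $k$ that is proper over $k$ (not assumed to be smooth, connected or commutative), and let $\phi\colon G\to A$ be a morphism of $k$-schemes such that $\phi(e)=0$. Then $\phi$ is a homomorphism of algebraic groups over $k$, that is, $\phi(g_1\cdot g_2)=\phi(g_1)+\phi(g_2)$ holds as an identity of morphisms $G\times_k G\to A$. -/

import Mathlib

universe u

open CategoryTheory AlgebraicGeometry
open scoped MonObj

/-! ### Tensor products over an algebraically closed field. -/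

section

open TensorProduct

/-! Base change to an algebraic closure is monoidal and faithful, so the identity may be checked
there. Over the closure `G` is integral: smoothness gives reducedness, connectedness survives
because of the unit section, and translations make a connected group irreducible. Put `ψ(g, h) =
φ(gh) φ(h)⁻¹ φ(g)⁻¹`. It is trivial on `{e} × G` and on `G × {e}`, and the claim is that it is
trivial.

Were `G` proper, the rigidity lemma would finish. In general one tests on curves
(`eq_one_of_lift_eq_one`). If `ψ(·, y)` is nontrivial for some closed point `y`, there is a curve `D
⟶ G` through `e` leaving the closed set where `ψ(·, y)` is trivial, with `D` open in a complete
regular curve `C` (`exists_curve`). Let `F` be the pullback of `ψ` to `D × G`. It extends to `C × U`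
for some nonempty open `U` of `G` (`exists_extension_of_hasUniformizerAt`): the points of `C × G`
over the generic point of `G` have valuation rings as local rings, so properness of `A` extends `F`
across them, and the remaining bad locus has closed image in `G` because `C` is universally closed.
Rigidity over `C` (`eq_comp_of_whiskerLeft_eq`), with triviality on `{c₀} × U`, shows that the
extension depends only on the `C`-coordinate. As `F` is trivial on `D × {e}`, it is trivial
(`eq_one_of_curve`), a contradiction. -/

theorem exists_algHom_ker_eq_of_isMaximal {k A : Type*} [Field k] [IsAlgClosed k] [CommRing A]
    [Algebra k A] [Algebra.FiniteType k A] (M : Ideal A) [M.IsMaximal] :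
    ∃ ε : A →ₐ[k] k, RingHom.ker ε = M := by
  let _ : Field (A ⧸ M) := Ideal.Quotient.field M
  have : Module.Finite k (A ⧸ M) := finite_of_finite_type_of_isJacobsonRing k (A ⧸ M)
  have hb : Function.Bijective (algebraMap k (A ⧸ M)) :=
    IsAlgClosed.algebraMap_bijective_of_isIntegral
  let e : k ≃ₐ[k] A ⧸ M := AlgEquiv.ofBijective (Algebra.ofId k (A ⧸ M)) hb
  refine ⟨(e.symm : (A ⧸ M) →ₐ[k] k).comp (Ideal.Quotient.mkₐ k M), ?_⟩
  ext x
  simp [RingHom.mem_ker, Ideal.Quotient.eq_zero_iff_mem]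

theorem exists_algHom_apply_ne_zero {k A : Type*} [Field k] [IsAlgClosed k] [CommRing A]
    [IsDomain A] [Algebra k A] [Algebra.FiniteType k A] {a : A} (ha : a ≠ 0) :
    ∃ ε : A →ₐ[k] k, ε a ≠ 0 := by
  have : IsJacobsonRing A := isJacobsonRing_of_finiteType (A := k)
  have hJ : (⊥ : Ideal A).jacobson = ⊥ :=
    IsJacobsonRing.out' _ (Ideal.isPrime_bot (α := A)).isRadical
  have : a ∉ (⊥ : Ideal A).jacobson := by rw [hJ]; simpa using ha
  rw [Ideal.jacobson, Ideal.mem_sInf] at this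
  push Not at this
  obtain ⟨M, ⟨-, hM⟩, haM⟩ := this
  obtain ⟨ε, hε⟩ := exists_algHom_ker_eq_of_isMaximal (k := k) M
  exact ⟨ε, fun h ↦ haM (hε ▸ h)⟩

/-- The tensor product of two domains over an algebraically closed field is a domain, if one of
them is of finite type. -/
theorem TensorProduct.isDomain_of_isAlgClosed (k A B : Type*) [Field k] [IsAlgClosed k]
    [CommRing A] [IsDomain A] [Algebra k A] [Algebra.FiniteType k A]
    [CommRing B] [IsDomain B] [Algebra k B] : IsDomain (A ⊗[k] B) := by
  -- Expand `x` in a `k`-basis of `B` with coefficients in `A` and let `a` be a nonzero coefficient: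
  -- specializing `A` at a `k`-point where `a` survives keeps `x` nonzero. For two factors, one
  -- point avoiding the product of their coefficients serves both.
  have key (x : A ⊗[k] B) (hx : x ≠ 0) : ∃ a : A, a ≠ 0 ∧ ∀ ε : A →ₐ[k] k, ε a ≠ 0 →
      Algebra.TensorProduct.lift ((Algebra.ofId k B).comp ε) (AlgHom.id k B)
        (fun _ _ ↦ .all _ _) x ≠ 0 := by
    let b := Module.Free.chooseBasis k B
    let b' := b.baseChange A
    obtain ⟨i, hi⟩ : ∃ i, b'.repr x i ≠ 0 := by
      by_contra! h
      exact hx (b'.repr.map_eq_zero_iff.mp (Finsupp.ext h))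
    refine ⟨b'.repr x i, hi, fun ε hε h ↦ hε ?_⟩
    have comm (y : A ⊗[k] B) : ε (b'.repr y i) = b.repr (Algebra.TensorProduct.lift
        ((Algebra.ofId k B).comp ε) (AlgHom.id k B) (fun _ _ ↦ .all _ _) y) i := by
      induction y with
      | zero => simp
      | add x y hx hy => simp [hx, hy]
      | tmul a c =>
        rw [Algebra.TensorProduct.lift_tmul]
        simp [b', Algebra.ofId_apply, Algebra.algebraMap_eq_smul_one, mul_comm]
    rw [comm, h]
    simp
  have : Nontrivial (A ⊗[k] B) := by
    refine (Algebra.TensorProduct.includeRight_injective (R := k) (A := A) (B := B) ?_).nontrivial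
    exact (algebraMap k A).injective
  have : NoZeroDivisors (A ⊗[k] B) := by
    refine ⟨fun {x y} hxy ↦ ?_⟩
    by_contra! h
    obtain ⟨a, ha, hxa⟩ := key x h.1
    obtain ⟨b, hb, hyb⟩ := key y h.2
    obtain ⟨ε, hε⟩ := exists_algHom_apply_ne_zero (k := k) (mul_ne_zero ha hb)
    rw [map_mul] at hε
    refine mul_ne_zero (hxa ε (left_ne_zero_of_mul hε)) (hyb ε (right_ne_zero_of_mul hε)) ?_
    rw [← map_mul, hxy, map_zero]
  exact NoZeroDivisors.to_isDomain _

/-- If the maximal ideal `m` of `B` is locally principal with residue field `k`, then the prime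
ideals of `B ⊗[k] R` lying over `m` and over `0` are locally principal. -/
theorem TensorProduct.exists_mul_mem_span_of_comap_eq_bot {k B R : Type*} [Field k] [IsAlgClosed k]
    [CommRing B] [Algebra k B] [Algebra.FiniteType k B] [CommRing R] [Algebra k R]
    (m : Ideal B) [m.IsMaximal] (π : B) (hπ : π ∈ m)
    (hm : ∀ x ∈ m, ∃ s ∉ m, s * x ∈ Ideal.span {π})
    (q : Ideal (B ⊗[k] R)) [q.IsPrime]
    (hq : q.comap (Algebra.TensorProduct.includeLeft : B →ₐ[k] B ⊗[k] R) = m)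
    (hq' : q.comap (Algebra.TensorProduct.includeRight : R →ₐ[k] B ⊗[k] R) = ⊥) :
    π ⊗ₜ[k] (1 : R) ∈ q ∧ ∀ x ∈ q, ∃ s ∉ q, s * x ∈ Ideal.span {π ⊗ₜ[k] (1 : R)} := by
  have hmem (b : B) : b ⊗ₜ[k] (1 : R) ∈ q ↔ b ∈ m := by rw [← hq]; rfl
  obtain ⟨ε, hε⟩ := exists_algHom_ker_eq_of_isMaximal (k := k) m
  let I := m.map (Algebra.TensorProduct.includeLeft : B →ₐ[k] B ⊗[k] R)
  have hI : I ≤ q := Ideal.map_le_iff_le_comap.mpr hq.ge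
  -- Since `B = k + m`, every tensor is congruent to some `1 ⊗ r` modulo the extension `I` of `m`.
  -- As `q` meets `R` in zero, this forces `q = I`.
  have h1 (t : B ⊗[k] R) : ∃ r : R, t - 1 ⊗ₜ r ∈ I := by
    induction t with
    | zero => exact ⟨0, by simp⟩
    | add x y hx hy =>
      obtain ⟨r, hr⟩ := hx
      obtain ⟨s, hs⟩ := hy
      refine ⟨r + s, ?_⟩
      rw [TensorProduct.tmul_add, add_sub_add_comm]
      exact add_mem hr hs
    | tmul b r =>
      refine ⟨ε b • r, ?_⟩
      have : b - algebraMap k B (ε b) ∈ m := by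
        rw [← hε, RingHom.mem_ker]; simp
      have := I.mul_mem_left (1 ⊗ₜ r) (Ideal.mem_map_of_mem
        (Algebra.TensorProduct.includeLeft : B →ₐ[k] B ⊗[k] R) this)
      convert! this using 1
      simp [Algebra.algebraMap_eq_smul_one, mul_sub, TensorProduct.sub_tmul,
        TensorProduct.smul_tmul']
  have hqI : q = I := by
    refine le_antisymm (fun t ht ↦ ?_) hI
    obtain ⟨r, hr⟩ := h1 t
    have : (1 : B) ⊗ₜ[k] r ∈ q := by simpa using sub_mem ht (hI hr)
    have : r ∈ q.comap (Algebra.TensorProduct.includeRight : R →ₐ[k] B ⊗[k] R) := this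
    rw [hq', Ideal.mem_bot] at this
    simpa [this] using hr
  refine ⟨(hmem _).mpr hπ, fun x hx ↦ ?_⟩
  rw [hqI] at hx
  induction hx using Submodule.span_induction with
  | mem x h =>
    obtain ⟨b, hb, rfl⟩ := h
    obtain ⟨s, hs, hsb⟩ := hm b hb
    refine ⟨s ⊗ₜ 1, (hmem s).not.mpr hs, ?_⟩
    have := Ideal.mem_map_of_mem (Algebra.TensorProduct.includeLeft : B →ₐ[k] B ⊗[k] R) hsb
    rw [Ideal.map_span, Set.image_singleton] at this
    simpa using this
  | zero => exact ⟨1, q.one_notMem, by simp⟩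
  | add x y _ _ hx hy =>
    obtain ⟨s, hs, hsx⟩ := hx
    obtain ⟨t, ht, hty⟩ := hy
    refine ⟨s * t, ‹q.IsPrime›.mul_notMem hs ht, ?_⟩
    have : s * t * (x + y) = t * (s * x) + s * (t * y) := by ring
    rw [this]
    exact add_mem (Ideal.mul_mem_left _ _ hsx) (Ideal.mul_mem_left _ _ hty)
  | smul a x _ hx =>
    obtain ⟨s, hs, hsx⟩ := hx
    refine ⟨s, hs, ?_⟩
    have : s * (a • x) = a * (s * x) := by simp [mul_left_comm]
    rw [this]
    exact Ideal.mul_mem_left _ _ hsx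

end

/-! ### Reducedness of smooth algebras over a domain. -/

/-- By flatness `S` embeds in its generic fibre, which is unramified over a field and hence reduced.
-/
theorem Algebra.Etale.isReduced_of_isDomain (R S : Type*) [CommRing R] [IsDomain R] [CommRing S]
    [Algebra R S] [Algebra.Etale R S] : IsReduced S := by
  let F := FractionRing R
  have : Module.Flat R S := inferInstance
  have : IsReduced (TensorProduct R F S) := Algebra.FormallyUnramified.isReduced_of_field F _
  have hinj : Function.Injective
      (Algebra.TensorProduct.includeRight : S →ₐ[R] TensorProduct R F S) :=
    Algebra.TensorProduct.includeRight_injective (IsFractionRing.injective R F)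
  exact isReduced_of_injective _ hinj

theorem RingHom.IsStandardSmooth.isReduced {R S : Type*} [CommRing R] [IsDomain R] [CommRing S]
    {f : R →+* S} (hf : f.IsStandardSmooth) : IsReduced S := by
  obtain ⟨n, g, -, hg⟩ := hf.exists_etale_mvPolynomial
  algebraize [g]
  exact Algebra.Etale.isReduced_of_isDomain (MvPolynomial (Fin n) R) S

/-! ### Curves through a point of an affine variety. -/

/-- A finitely generated algebra which is a domain admits, through any maximal ideal `m` and
not contained in a given hypersurface through `m`, an integral closed curve. -/
theorem exists_isPrime_le_and_isIntegral_adjoin {k B : Type*} [Field k] [IsAlgClosed k]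
    [CommRing B] [IsDomain B] [Algebra k B] [Algebra.FiniteType k B] (m : Ideal B) [m.IsMaximal]
    {f : B} (hf : f ≠ 0) (hfm : f ∈ m) :
    ∃ p : Ideal B, p.IsPrime ∧ p ≤ m ∧ f ∉ p ∧ ∃ t : B ⧸ p, Transcendental k t ∧
      ∀ x : B ⧸ p, IsIntegral (Algebra.adjoin k {t}) x := by
  obtain ⟨n, g, hg, hgint⟩ := exists_integral_inj_algHom_of_fg k B
  let R := MvPolynomial (Fin n) k
  algebraize [g.toRingHom]
  have hgR (r : R) : algebraMap R B r = g r := rfl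
  have : FaithfulSMul R B := (faithfulSMul_iff_algebraMap_injective R B).mpr hg
  obtain ⟨ε, hε⟩ := exists_algHom_ker_eq_of_isMaximal (k := k) m
  -- After Noether normalization, `f` divides a nonzero polynomial `a₀`, which therefore vanishes at
  -- the image `a` of the point `m`. It suffices to find a curve on which `a₀` is nonzero.
  obtain ⟨a₀, ha₀, hfa⟩ := ((Algebra.IsIntegral.isIntegral (R := R) f).isAlgebraic).exists_nonzero_dvd
    (mem_nonZeroDivisors_of_ne_zero hf)
  let a : Fin n → k := fun i ↦ ε (g (.X i))
  have hεg : ε.comp g = MvPolynomial.aeval a := by ext; simp [a]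
  have haa₀ : MvPolynomial.aeval a a₀ = 0 := by
    have : algebraMap R B a₀ ∈ m := Ideal.mem_of_dvd _ hfa hfm
    rw [← hε, RingHom.mem_ker] at this
    rw [← hεg]; exact this
  obtain ⟨b, hb⟩ : ∃ b : Fin n → k, MvPolynomial.aeval b a₀ ≠ 0 := by
    by_contra! h
    exact ha₀ (MvPolynomial.funext fun x ↦ by simpa [MvPolynomial.aeval_eq_eval] using h x)
  obtain ⟨i, hi⟩ : ∃ i, b i - a i ≠ 0 := by
    by_contra! h
    have : b = a := funext fun i ↦ sub_eq_zero.mp (h i)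
    exact hb (this ▸ haa₀)
  -- Restriction to the line through `a` (parameter `0`) and a point `b` (parameter `1`) with `a₀(b)
  -- ≠ 0`.
  let l : R →ₐ[k] Polynomial k := MvPolynomial.aeval
    fun i ↦ Polynomial.C (a i) + Polynomial.X * Polynomial.C (b i - a i)
  have hl₀ : (Polynomial.aeval (0 : k)).comp l = MvPolynomial.aeval a := by ext; simp [l]
  have hl₁ : (Polynomial.aeval (1 : k)).comp l = MvPolynomial.aeval b := by ext; simp [l]
  have hla₀ : l a₀ ≠ 0 := fun h ↦ hb (by rw [← hl₁, AlgHom.comp_apply, h, map_zero])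
  -- A linear function restricting to the parameter of the line; its image in `B ⧸ p` is the
  -- required `t`.
  let r : R := MvPolynomial.C (b i - a i)⁻¹ * (MvPolynomial.X i - MvPolynomial.C (a i))
  have hr : l r = Polynomial.X := by
    have : Polynomial.C (b i - a i)⁻¹ * Polynomial.C (b i - a i) = (1 : Polynomial k) := by
      rw [← Polynomial.C_mul, inv_mul_cancel₀ hi, Polynomial.C_1]
    have hlX : l (.X i) = Polynomial.C (a i) + Polynomial.X * Polynomial.C (b i - a i) :=
      MvPolynomial.aeval_X _ _
    have hlC (c : k) : l (.C c) = Polynomial.C c := MvPolynomial.aeval_C _ _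
    rw [map_mul, map_sub, hlX, hlC, hlC]
    linear_combination Polynomial.X * this
  have hlr (F : Polynomial k) : l (Polynomial.aeval r F) = F := by
    rw [← Polynomial.aeval_algHom_apply, hr, Polynomial.aeval_X_left_apply]
  have hle : RingHom.ker l ≤ m.under R := by
    intro x hx
    rw [RingHom.mem_ker] at hx
    change algebraMap R B x ∈ m
    rw [← hε, RingHom.mem_ker]
    change (ε.comp g) x = 0
    rw [hεg, ← hl₀, AlgHom.comp_apply, hx, map_zero]
  have : (RingHom.ker l).IsPrime := RingHom.ker_isPrime l
  -- Going down lifts the line to a curve through `m`.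
  obtain ⟨p, hpm, hp, hpl⟩ := Ideal.exists_ideal_le_liesOver_of_le (p := RingHom.ker l)
    (q := m.under R) m hle
  have hmem (x : R) : g x ∈ p ↔ l x = 0 := by
    have := hpl.over
    rw [← RingHom.mem_ker, this]; rfl
  let t : B ⧸ p := Ideal.Quotient.mkₐ k p (g r)
  have htF (F : Polynomial k) : Polynomial.aeval t F
      = Ideal.Quotient.mkₐ k p (g (Polynomial.aeval r F)) := by
    simp only [t, Polynomial.aeval_algHom_apply]
  refine ⟨p, hp, hpm, fun hfp ↦ hla₀ ((hmem _).mp (Ideal.mem_of_dvd _ hfa hfp)), t, ?_, ?_⟩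
  · rw [transcendental_iff]
    intro F hF
    rw [htF] at hF
    have := (hmem _).mp (Ideal.Quotient.eq_zero_iff_mem.mp hF)
    rwa [hlr] at this
  · intro x
    obtain ⟨y, rfl⟩ := Ideal.Quotient.mk_surjective x
    obtain ⟨P, hP, hPy⟩ := hgint y
    have hrange (z : R) : Ideal.Quotient.mk p (g z) ∈ Algebra.adjoin k {t} := by
      rw [Algebra.adjoin_singleton_eq_range_aeval]
      refine ⟨l z, ?_⟩
      change Polynomial.aeval t (l z) = _
      rw [htF]
      refine Ideal.Quotient.eq.mpr ?_
      rw [← map_sub, hmem, map_sub, hlr, sub_self]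
    let σ : R →+* Algebra.adjoin k {t} :=
      ((Ideal.Quotient.mk p).comp g.toRingHom).codRestrict _ hrange
    refine ⟨P.map σ, hP.map _, ?_⟩
    rw [Polynomial.eval₂_map]
    have h2 : (algebraMap (Algebra.adjoin k {t}) (B ⧸ p)).comp σ =
      (Ideal.Quotient.mk p).comp g.toRingHom := rfl
    rw [h2, ← Polynomial.hom_eval₂]
    rw [show Polynomial.eval₂ g.toRingHom y P = 0 from hPy, map_zero]

/-! ### Function fields of one variable and their rings of integral elements. -/

open IntermediateField.algebraAdjoinAdjoin in
/-- A function field of one variable over a perfect field has a separating element. -/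
theorem exists_finiteDimensional_isSeparable_adjoin {k K : Type*} [Field k] [PerfectField k]
    [Field K] [Algebra k K] [Algebra.EssFiniteType k K] (t : K) (ht : Transcendental k t)
    (h : Algebra.IsAlgebraic (Algebra.adjoin k {t}) K) :
    ∃ x : K, x ≠ 0 ∧ FiniteDimensional (IntermediateField.adjoin k {x}) K ∧
      Algebra.IsSeparable (IntermediateField.adjoin k {x}) K := by
  have htr : IsTranscendenceBasis k ((↑) : ({t} : Set K) → K) := by
    rw [isTranscendenceBasis_iff_algebraicIndependent_isAlgebraic]
    refine ⟨algebraicIndependent_unique_type_iff.mpr ht, ?_⟩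
    rwa [Subtype.range_coe]
  obtain ⟨s, hs, hsep⟩ := exists_isTranscendenceBasis_and_isSeparable_of_perfectField k K
  -- The transcendence degree is one, so the separating transcendence basis is a single element.
  have hcard := htr.cardinalMk_eq_trdeg.trans hs.cardinalMk_eq_trdeg.symm
  obtain ⟨x, hx⟩ : ∃ x, s = {x} := by
    rw [← Finset.card_eq_one]
    simpa [eq_comm] using hcard
  subst hx
  rw [Finset.coe_singleton] at hsep
  have : Algebra.EssFiniteType (IntermediateField.adjoin k {x}) K :=
    Algebra.EssFiniteType.of_comp k _ _
  refine ⟨x, ?_, Algebra.finite_of_essFiniteType_of_isAlgebraic, hsep⟩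
  rintro rfl
  exact ((algebraicIndependent_singleton_iff ⟨0, by simp⟩).mp hs.1) isAlgebraic_zero

section

variable (k : Type*) {K : Type*} [Field k] [Field K] [Algebra k K]

/-- The integral closure in `K` of the `k`-algebra generated by `s`. -/
def integralClosureAdjoin (s : Set K) : Subalgebra k K :=
  (integralClosure (Algebra.adjoin k s) K).restrictScalars k

variable {k}

theorem mem_integralClosureAdjoin {s : Set K} {y : K} :
    y ∈ integralClosureAdjoin k s ↔ IsIntegral (Algebra.adjoin k s) y := Iff.rfl

theorem subset_integralClosureAdjoin (s : Set K) : s ⊆ integralClosureAdjoin k s :=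
  fun x hx ↦ isIntegral_algebraMap (R := Algebra.adjoin k s) (x := ⟨x, Algebra.subset_adjoin hx⟩)

theorem integralClosureAdjoin_mono {s t : Set K} (h : s ⊆ t) :
    integralClosureAdjoin k s ≤ integralClosureAdjoin k t := by
  intro y hy
  rw [mem_integralClosureAdjoin] at hy ⊢
  obtain ⟨P, hP, hPy⟩ := hy
  refine ⟨P.map (Subalgebra.inclusion (Algebra.adjoin_mono h)).toRingHom, hP.map _, ?_⟩
  rwa [Polynomial.eval₂_map]

theorem integralClosureAdjoin_le_of_valuationSubring (V : ValuationSubring K) {s : Set K}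
    (hs : s ⊆ V) (hk : ∀ a : k, algebraMap k K a ∈ V) {y : K}
    (hy : y ∈ integralClosureAdjoin k s) : y ∈ V := by
  let V' : Subalgebra k K := { V.toSubring with algebraMap_mem' := hk }
  have hV' : Algebra.adjoin k s ≤ V' := Algebra.adjoin_le hs
  obtain ⟨P, hP, hPy⟩ := hy
  have : IsIntegral V y := by
    refine ⟨P.map (show Algebra.adjoin k s →+* V from (Subalgebra.inclusion hV').toRingHom),
      hP.map _, ?_⟩
    rw [Polynomial.eval₂_map]
    exact hPy
  obtain ⟨z, hz⟩ := IsIntegrallyClosed.isIntegral_iff.mp this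
  exact hz ▸ z.2

theorem isLocalization_away_inclusion {S T : Subalgebra k K} (hST : S ≤ T) {x : K} (hx : x ≠ 0)
    (hxS : x ∈ S) (hxT : x⁻¹ ∈ T) (h : ∀ y ∈ T, ∃ n : ℕ, x ^ n * y ∈ S) :
    letI := (Subalgebra.inclusion hST).toRingHom.toAlgebra
    IsLocalization.Away (⟨x, hxS⟩ : S) T := by
  let _ := (Subalgebra.inclusion hST).toRingHom.toAlgebra
  have hmap (s : S) : ((algebraMap S T s : T) : K) = s := rfl
  refine ⟨?_, ?_, ?_⟩
  · rintro ⟨_, n, rfl⟩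
    rw [map_pow]
    refine IsUnit.pow _ (IsUnit.of_mul_eq_one ⟨x⁻¹, hxT⟩ (Subtype.ext ?_))
    exact mul_inv_cancel₀ hx
  · rintro ⟨y, hy⟩
    obtain ⟨n, hn⟩ := h y hy
    refine ⟨⟨⟨_, hn⟩, ⟨_, n, rfl⟩⟩, Subtype.ext ?_⟩
    simp [hmap, mul_comm]
  · intro a b hab
    refine ⟨1, ?_⟩
    have : (a : K) = b := congr(($hab : K))
    rw [Subtype.ext this]

theorem exists_pow_mul_mem_adjoin_singleton {x : K} (hx : x ≠ 0) {y : K}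
    (hy : y ∈ Algebra.adjoin k {x, x⁻¹}) : ∃ n : ℕ, x ^ n * y ∈ Algebra.adjoin k {x} := by
  have hx1 : x ∈ Algebra.adjoin k {x} := Algebra.self_mem_adjoin_singleton k x
  induction hy using Algebra.adjoin_induction with
  | mem y hy =>
    obtain rfl | rfl := hy
    · exact ⟨0, by simp⟩
    · exact ⟨1, by simp [hx, one_mem]⟩
  | algebraMap a => exact ⟨0, by simp⟩
  | add y z _ _ hy hz =>
    obtain ⟨n, hn⟩ := hy
    obtain ⟨m, hm⟩ := hz
    refine ⟨n + m, ?_⟩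
    have : x ^ (n + m) * (y + z) = x ^ m * (x ^ n * y) + x ^ n * (x ^ m * z) := by ring
    rw [this]
    exact add_mem (mul_mem (pow_mem hx1 _) hn) (mul_mem (pow_mem hx1 _) hm)
  | mul y z _ _ hy hz =>
    obtain ⟨n, hn⟩ := hy
    obtain ⟨m, hm⟩ := hz
    refine ⟨n + m, ?_⟩
    have : x ^ (n + m) * (y * z) = (x ^ n * y) * (x ^ m * z) := by ring
    rw [this]
    exact mul_mem hn hm

/-- Integral closure commutes with inverting `x`. This makes the overlap of the two charts of the
complete curve a basic open set in each. -/
theorem exists_isIntegral_pow_mul {S T : Subalgebra k K} (hST : S ≤ T) {x : K} (hx : x ≠ 0)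
    (hxS : x ∈ S) (hxT : x⁻¹ ∈ T) (h : ∀ y ∈ T, ∃ n : ℕ, x ^ n * y ∈ S) {y : K}
    (hy : IsIntegral T y) : ∃ n : ℕ, IsIntegral S (x ^ n * y) := by
  let _ := (Subalgebra.inclusion hST).toRingHom.toAlgebra
  have := isLocalization_away_inclusion hST hx hxS hxT h
  have : IsScalarTower S T K := .of_algebraMap_eq fun _ ↦ rfl
  obtain ⟨⟨m, hm⟩, hn⟩ := hy.exists_multiple_integral_of_isLocalization
    (.powers (⟨x, hxS⟩ : S))
  obtain ⟨n, rfl⟩ := hm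
  refine ⟨n, ?_⟩
  rw [Submonoid.smul_def, Algebra.smul_def] at hn
  convert! hn using 2

theorem exists_pow_mul_mem_integralClosureAdjoin {x : K} (hx : x ≠ 0) {y : K}
    (hy : y ∈ integralClosureAdjoin k {x, x⁻¹}) :
    ∃ n : ℕ, x ^ n * y ∈ integralClosureAdjoin k {x} :=
  exists_isIntegral_pow_mul (Algebra.adjoin_mono (by simp)) hx
    (Algebra.self_mem_adjoin_singleton k x) (Algebra.subset_adjoin (by simp))
    (fun _ hy ↦ exists_pow_mul_mem_adjoin_singleton hx hy) hy

theorem isLocalization_away_integralClosureAdjoin {x : K} (hx : x ≠ 0) {s : Set K}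
    (hs : s = {x, x⁻¹}) (hle : integralClosureAdjoin k {x} ≤ integralClosureAdjoin k s) :
    letI := (Subalgebra.inclusion hle).toRingHom.toAlgebra
    IsLocalization.Away (⟨x, subset_integralClosureAdjoin {x} rfl⟩ : integralClosureAdjoin k {x})
      (integralClosureAdjoin k s) := by
  subst hs
  exact isLocalization_away_inclusion hle hx _ (subset_integralClosureAdjoin _ (by simp))
    fun y hy ↦ exists_pow_mul_mem_integralClosureAdjoin hx hy

instance (x : K) : IsPrincipalIdealRing (Algebra.adjoin k {x}) := by
  refine IsPrincipalIdealRing.of_surjective (((Polynomial.aeval x).codRestrict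
    (Algebra.adjoin k {x}) fun p ↦ ?_).toRingHom : Polynomial k →+* _) ?_
  · rw [Algebra.adjoin_singleton_eq_range_aeval]; exact ⟨p, rfl⟩
  · rintro ⟨y, hy⟩
    obtain ⟨p, hp⟩ := (Algebra.adjoin_singleton_eq_range_aeval k x) ▸ hy
    exact ⟨p, Subtype.ext hp⟩

variable (x : K) [FiniteDimensional (IntermediateField.adjoin k {x}) K]
  [Algebra.IsSeparable (IntermediateField.adjoin k {x}) K]

open IntermediateField.algebraAdjoinAdjoin

instance : IsDedekindDomain (integralClosureAdjoin k {x}) :=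
  integralClosure.isDedekindDomain (Algebra.adjoin k {x}) (IntermediateField.adjoin k {x}) K

instance : IsFractionRing (integralClosureAdjoin k {x}) K :=
  integralClosure.isFractionRing_of_finite_extension (A := Algebra.adjoin k {x})
    (IntermediateField.adjoin k {x}) K

/-- Separability makes the integral closure finite over `k[x]`; this is why a separating element is
chosen. -/
instance : Algebra.FiniteType k (integralClosureAdjoin k {x}) := by
  have hfin : Module.Finite (Algebra.adjoin k {x}) (integralClosure (Algebra.adjoin k {x}) K) :=
    IsIntegralClosure.finite (Algebra.adjoin k {x}) (IntermediateField.adjoin k {x}) K _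
  have h1 : Algebra.FiniteType k (Algebra.adjoin k {x}) :=
    (Algebra.adjoin k {x}).fg_iff_finiteType.mp ⟨{x}, by simp⟩
  let _ : Algebra (Algebra.adjoin k {x}) (integralClosureAdjoin k {x}) :=
    (integralClosure (Algebra.adjoin k {x}) K).algebra
  have : IsScalarTower k (Algebra.adjoin k {x}) (integralClosureAdjoin k {x}) :=
    .of_algebraMap_eq fun _ ↦ rfl
  have : Module.Finite (Algebra.adjoin k {x}) (integralClosureAdjoin k {x}) := hfin
  exact Algebra.FiniteType.trans (S := Algebra.adjoin k {x}) h1 inferInstance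

end

/-! ### Mapping an open part of a regular curve to a variety. -/

/-- A Dedekind domain inside a valuation ring of its fraction field becomes equal to it after
localizing at the center. -/
theorem ValuationSubring.exists_mul_mem_of_isDedekindDomain {R K : Type*} [CommRing R]
    [IsDedekindDomain R] [Field K] [Algebra R K] [IsFractionRing R K] (V : ValuationSubring K)
    (hR : ∀ r : R, algebraMap R K r ∈ V) {v : K} (hv : v ∈ V) :
    ∃ s t : R, algebraMap R K s ∉ V.nonunits ∧ algebraMap R K s * v = algebraMap R K t := by
  let j : R →+* V := (algebraMap R K).codRestrict V.toSubring hR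
  let q : Ideal R := (IsLocalRing.maximalIdeal V).comap j
  have hq (r : R) : r ∈ q ↔ algebraMap R K r ∈ V.nonunits := by
    rw [V.mem_nonunits_iff_exists_mem_maximalIdeal]
    exact ⟨fun h ↦ ⟨_, h⟩, fun ⟨_, h⟩ ↦ h⟩
  have hqp : q.IsPrime := Ideal.IsPrime.comap _
  obtain ⟨a, b, hb, rfl⟩ := IsFractionRing.div_surjective (A := R) v
  have hb0 : algebraMap R K b ≠ 0 := by
    simpa using nonZeroDivisors.ne_zero hb
  by_cases hq0 : q = ⊥
  · refine ⟨b, a, ?_, by field_simp⟩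
    rw [← hq, hq0, Ideal.mem_bot]
    exact nonZeroDivisors.ne_zero hb
  have := IsLocalization.AtPrime.isDiscreteValuationRing_of_dedekind_domain R hq0
    (Localization.AtPrime q)
  have hinj : Function.Injective (algebraMap R (Localization.AtPrime q)) :=
    IsLocalization.injective _ q.primeCompl_le_nonZeroDivisors
  have cond := ValuationRing.cond (algebraMap R (Localization.AtPrime q) a) (algebraMap R _ b)
  obtain ⟨c, hc⟩ := cond
  obtain ⟨c₁, c₂, rfl⟩ := IsLocalization.exists_mk'_eq q.primeCompl c
  have aux (x y : R) (h : algebraMap R (Localization.AtPrime q) x *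
      IsLocalization.mk' _ c₁ c₂ = algebraMap R _ y) : x * c₁ = y * c₂ := by
    apply hinj
    rw [map_mul, map_mul, ← h, mul_assoc, IsLocalization.mk'_spec]
  obtain hc | hc := hc
  -- Here `v = c₂ / c₁` with `c₂` outside the center. As `v ∈ V`, the denominator `c₁` is outside it
  -- too.
  · have h := aux _ _ hc
    have h' := congr(algebraMap R K $h)
    rw [map_mul, map_mul] at h'
    have hvc : algebraMap R K c₁ * (algebraMap R K a / algebraMap R K b) =
        algebraMap R K c₂ := by
      field_simp
      linear_combination h'
    refine ⟨c₁, c₂, fun hc₁ ↦ c₂.2 ?_, hvc⟩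
    rw [← hq] at hc₁
    have : j c₂ ∈ IsLocalRing.maximalIdeal V := by
      have : j c₂ = j c₁ * ⟨_, hv⟩ := Subtype.ext hvc.symm
      rw [this]
      exact Ideal.mul_mem_right _ _ hc₁
    exact this
  · have h := aux _ _ hc
    have h' := congr(algebraMap R K $h)
    rw [map_mul, map_mul] at h'
    refine ⟨c₂, c₁, (hq _).not.mp c₂.2, ?_⟩
    field_simp
    linear_combination -h'

/-- The elements of `K` which become members of `S` after multiplication by a power of `s`. -/
def Subalgebra.away {k K : Type*} [Field k] [Field K] [Algebra k K] (S : Subalgebra k K)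
    (s : S) : Subalgebra k K where
  carrier := {y | ∃ n : ℕ, (s : K) ^ n * y ∈ S}
  mul_mem' := by
    rintro y z ⟨n, hn⟩ ⟨m, hm⟩
    refine ⟨n + m, ?_⟩
    have : (s : K) ^ (n + m) * (y * z) = (s ^ n * y) * (s ^ m * z) := by ring
    rw [this]
    exact mul_mem hn hm
  add_mem' := by
    rintro y z ⟨n, hn⟩ ⟨m, hm⟩
    refine ⟨n + m, ?_⟩
    have : (s : K) ^ (n + m) * (y + z) = s ^ m * (s ^ n * y) + s ^ n * (s ^ m * z) := by ring
    rw [this]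
    exact add_mem (mul_mem (pow_mem s.2 _) hn) (mul_mem (pow_mem s.2 _) hm)
  algebraMap_mem' a := ⟨0, by simp⟩

/-- Through any maximal ideal `m` of an affine variety and not inside a given hypersurface, there
is a morphism from an open part of the regular complete curve with a given function field. -/
theorem exists_algHom_isLocalization_away {k B : Type u} [Field k] [IsAlgClosed k]
    [CommRing B] [IsDomain B] [Algebra k B] [Algebra.FiniteType k B] (m : Ideal B) [m.IsMaximal]
    {f : B} (hf : f ≠ 0) (hfm : f ∈ m) :
    ∃ (K : Type u) (_ : Field K) (_ : Algebra k K) (x : K) (_ : x ≠ 0)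
      (_ : FiniteDimensional (IntermediateField.adjoin k {x}) K)
      (_ : Algebra.IsSeparable (IntermediateField.adjoin k {x}) K)
      (T : Subalgebra k K) (hT : integralClosureAdjoin k {x} ≤ T)
      (s : integralClosureAdjoin k {x}) (h : B →ₐ[k] T) (n : Ideal T),
      (letI := (Subalgebra.inclusion hT).toRingHom.toAlgebra
       IsLocalization.Away s T) ∧ n.IsMaximal ∧ n.comap h = m ∧ h f ≠ 0 := by
  classical
  obtain ⟨p, hp, hpm, hfp, t, ht, hint⟩ := exists_isPrime_le_and_isIntegral_adjoin (k := k) m hf hfm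
  let A := B ⧸ p
  let K := FractionRing A
  let θ : B →ₐ[k] K := (IsScalarTower.toAlgHom k A K).comp (Ideal.Quotient.mkₐ k p)
  have hθ (b : B) : θ b = 0 ↔ b ∈ p := by
    change algebraMap A K (Ideal.Quotient.mk p b) = 0 ↔ _
    rw [FaithfulSMul.algebraMap_eq_zero_iff, Ideal.Quotient.eq_zero_iff_mem]
  have htK : Transcendental k (algebraMap A K t) :=
    (transcendental_algebraMap_iff (IsFractionRing.injective A K)).mpr ht
  have : Algebra.EssFiniteType k K := Algebra.EssFiniteType.comp k A K
  have halg : Algebra.IsAlgebraic (Algebra.adjoin k {algebraMap A K t}) K := by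
    have hmap (z : Algebra.adjoin k {t}) :
        algebraMap A K z ∈ Algebra.adjoin k {algebraMap A K t} := by
      have := AlgHom.map_adjoin (IsScalarTower.toAlgHom k A K) {t}
      rw [Set.image_singleton] at this
      exact this ▸ ⟨z, z.2, rfl⟩
    let σ : Algebra.adjoin k {t} →+* Algebra.adjoin k {algebraMap A K t} :=
      ((algebraMap A K).comp (Algebra.adjoin k {t}).val.toRingHom).codRestrict _ hmap
    have h1 (a : A) : IsAlgebraic (Algebra.adjoin k {algebraMap A K t}) (algebraMap A K a) :=
      ((hint a).map_of_comp_eq σ (algebraMap A K) rfl).isAlgebraic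
    refine ⟨fun z ↦ ?_⟩
    obtain ⟨a, b, -, rfl⟩ := IsFractionRing.div_surjective (A := A) z
    rw [div_eq_mul_inv]
    exact (h1 a).mul (h1 b).inv
  obtain ⟨y, hy0, hyf, hys⟩ := exists_finiteDimensional_isSeparable_adjoin _ htK halg
  -- The point `m` gives a proper ideal of the coordinate ring of the curve, so some valuation ring
  -- `V` of `K` contains that ring and is centered there. It selects the point of the regular curve
  -- lying over `m`.
  let I : Ideal θ.range.toSubring := m.map (θ.rangeRestrict : B →+* θ.range)
  have hI : I ≠ ⊤ := by
    intro h
    have h1 : (1 : θ.range) ∈ I := by rw [h]; trivial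
    obtain ⟨b, hb, hb1⟩ := (Ideal.mem_map_iff_of_surjective _ θ.rangeRestrict_surjective).mp h1
    have hb2 : θ (b - 1) = 0 := by
      rw [map_sub, map_one, sub_eq_zero]
      exact congr(($hb1 : K))
    have := sub_mem hb (hpm ((hθ _).mp hb2))
    rw [sub_sub_cancel] at this
    exact Ideal.IsPrime.ne_top' ((Ideal.eq_top_iff_one m).mpr this)
  obtain ⟨V, hV, hVm⟩ := Ideal.image_subset_nonunits_valuationSubring I hI
  -- Replacing `y` by its inverse if necessary puts the center of `V` in the chart of `x` without
  -- changing `k(x)`.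
  obtain ⟨x, hx0, hxf, hxs, hxV⟩ : ∃ x : K, x ≠ 0 ∧
      FiniteDimensional (IntermediateField.adjoin k {x}) K ∧
      Algebra.IsSeparable (IntermediateField.adjoin k {x}) K ∧ x ∈ V := by
    obtain h | h := V.mem_or_inv_mem y
    · exact ⟨y, hy0, hyf, hys, h⟩
    · have : IntermediateField.adjoin k {y⁻¹} = IntermediateField.adjoin k {y} := by
        refine le_antisymm ?_ ?_ <;> rw [IntermediateField.adjoin_simple_le_iff]
        · exact inv_mem (IntermediateField.mem_adjoin_simple_self k y)
        · have := inv_mem (IntermediateField.mem_adjoin_simple_self k y⁻¹)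
          rwa [inv_inv y] at this
      refine ⟨y⁻¹, inv_ne_zero hy0, ?_, ?_, h⟩ <;> rwa [this]
  have hVB (b : B) : θ b ∈ V := hV ⟨b, rfl⟩
  have hVm' {b : B} (hb : b ∈ m) : θ b ∈ V.nonunits :=
    hVm ⟨θ.rangeRestrict b, Ideal.mem_map_of_mem _ hb, rfl⟩
  have hVk (a : k) : algebraMap k K a ∈ V := by simpa using hVB (algebraMap k B a)
  let O := integralClosureAdjoin k {x}
  have hOV (y : O) : (y : K) ∈ V :=
    integralClosureAdjoin_le_of_valuationSubring V (by simpa using hxV) hVk y.2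
  have hex (b : B) : ∃ s t : O, (s : K) ∉ V.nonunits ∧ (s : K) * θ b = t :=
    V.exists_mul_mem_of_isDedekindDomain (R := O) hOV (hVB b)
  choose s t hs hst using hex
  have hv (b : B) : V.valuation (s b : K) = 1 :=
    le_antisymm ((V.valuation_le_one_iff _).mpr (hOV _))
      (not_lt.mp fun h ↦ hs b (V.mem_nonunits_iff.mpr h))
  obtain ⟨G, hG⟩ : (⊤ : Subalgebra k B).FG := Algebra.FiniteType.out
  -- A common denominator for the finitely many generators of `B`, still a unit of `V`. Inverting it
  -- makes the map regular on a neighbourhood of the center.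
  let s₀ : O := ∏ g ∈ G, s g
  have hv₀ : V.valuation (s₀ : K) = 1 := by
    simp only [s₀, SubmonoidClass.coe_finsetProd, map_prod]
    exact Finset.prod_eq_one fun g _ ↦ hv g
  have hs₀ : (s₀ : K) ≠ 0 := by
    intro h
    rw [h, map_zero] at hv₀
    exact zero_ne_one hv₀
  let T := O.away s₀
  have hOT : O ≤ T := fun y hy ↦ ⟨0, by simpa using hy⟩
  have hTV (y : T) : (y : K) ∈ V := by
    obtain ⟨y, n, hn⟩ := y
    have := hOV ⟨_, hn⟩
    rw [← V.valuation_le_one_iff] at this ⊢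
    simpa [hv₀] using this
  have hloc := isLocalization_away_inclusion hOT hs₀ s₀.2
    ⟨1, by simp [hs₀, one_mem]⟩ (fun y hy ↦ hy)
  have hθT (b : B) : θ b ∈ T := by
    have : (⊤ : Subalgebra k B) ≤ T.comap θ := by
      rw [← hG, Algebra.adjoin_le_iff]
      intro g hg
      refine ⟨1, ?_⟩
      have : (s₀ : K) * θ g = (∏ g ∈ G.erase g, s g : O) * t g := by
        simp only [s₀]
        rw [← Finset.prod_erase_mul _ _ hg, ← hst, MulMemClass.coe_mul, mul_assoc]
      rw [pow_one]
      change (s₀ : K) * θ g ∈ O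
      rw [this]
      exact mul_mem (Subtype.prop _) (Subtype.prop _)
    exact this trivial
  let j : T →+* V := T.val.toRingHom.codRestrict V.toSubring hTV
  -- The center of `V` on `T`. It is nonzero because it contains `h f`, hence maximal in the
  -- Dedekind domain `T`.
  let n : Ideal T := (IsLocalRing.maximalIdeal V).comap j
  have hnp : n.IsPrime := Ideal.IsPrime.comap _
  let h : B →ₐ[k] T := θ.codRestrict T hθT
  have hmn : m ≤ n.comap h := by
    intro b hb
    have := hVm' hb
    rw [V.mem_nonunits_iff_exists_mem_maximalIdeal] at this
    exact this.2
  have hhf : h f ≠ 0 := fun h0 ↦ hfp ((hθ f).mp congr(($h0 : K)))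
  have hTD : IsDedekindDomain T := by
    let _ := (Subalgebra.inclusion hOT).toRingHom.toAlgebra
    have : IsLocalization (.powers s₀) T := hloc
    refine IsLocalization.isDedekindDomain O (M := .powers s₀) ?_ T
    exact powers_le_nonZeroDivisors_of_noZeroDivisors fun h ↦ hs₀ congr(($h : K))
  have hn0 : n ≠ ⊥ := fun h0 ↦ hhf (by
    have : h f ∈ n := hmn hfm
    rwa [h0] at this)
  refine ⟨K, inferInstance, inferInstance, x, hx0, hxf, hxs, T, hOT, s₀, h, n, hloc,
    hnp.isMaximal hn0, ?_, hhf⟩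
  exact (‹m.IsMaximal›.eq_of_le (Ideal.IsPrime.comap h).ne_top hmn).symm

/-! ### Uniformizers and the algebra of the valuative criterion. -/

/-- A uniformizer of the discrete valuation ring at `p`, with denominators cleared. This form passes
to tensor products without mentioning localizations. -/
theorem IsDedekindDomain.exists_mul_mem_span_of_ne_bot {R : Type*} [CommRing R] [IsDedekindDomain R]
    {p : Ideal R} [p.IsPrime] (hp : p ≠ ⊥) :
    ∃ π ∈ p, ∀ x ∈ p, ∃ s ∉ p, s * x ∈ Ideal.span {π} := by
  have := IsLocalization.AtPrime.isDiscreteValuationRing_of_dedekind_domain R hp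
    (Localization.AtPrime p)
  have hinj : Function.Injective (algebraMap R (Localization.AtPrime p)) :=
    IsLocalization.injective _ p.primeCompl_le_nonZeroDivisors
  obtain ⟨ϖ, hϖ⟩ := (IsPrincipalIdealRing.principal
    (IsLocalRing.maximalIdeal (Localization.AtPrime p))).principal
  rw [Ideal.submodule_span_eq] at hϖ
  have hmem : ϖ ∈ IsLocalRing.maximalIdeal (Localization.AtPrime p) := by
    rw [hϖ]; exact Ideal.mem_span_singleton_self ϖ
  obtain ⟨a, s, rfl⟩ := IsLocalization.exists_mk'_eq p.primeCompl ϖ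
  refine ⟨a, (IsLocalization.AtPrime.mk'_mem_maximal_iff _ p a s).mp hmem, fun x hx ↦ ?_⟩
  have : algebraMap R (Localization.AtPrime p) x ∈ IsLocalRing.maximalIdeal _ :=
    (IsLocalization.AtPrime.to_map_mem_maximal_iff _ p x).mpr hx
  rw [hϖ, Ideal.mem_span_singleton] at this
  obtain ⟨y, hy⟩ := this
  obtain ⟨b, t, rfl⟩ := IsLocalization.exists_mk'_eq p.primeCompl y
  refine ⟨s * t, ‹p.IsPrime›.mul_notMem s.2 t.2, Ideal.mem_span_singleton.mpr ⟨b, hinj ?_⟩⟩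
  rw [map_mul, map_mul, map_mul, hy, ← IsLocalization.mk'_spec (Localization.AtPrime p) a s,
    ← IsLocalization.mk'_spec (Localization.AtPrime p) b t]
  ring

theorem exists_comp_eq_of_forall_mem_range {O R L : Type*} [CommRing O] [CommRing R] [CommRing L]
    [Algebra R L] (hR : Function.Injective (algebraMap R L)) (g : O →+* L)
    (hg : ∀ o, g o ∈ (algebraMap R L).range) : ∃ h : O →+* R, (algebraMap R L).comp h = g := by
  let e : R ≃+* (algebraMap R L).range := RingEquiv.ofBijective (algebraMap R L).rangeRestrict
    ⟨fun _ _ h ↦ hR congr(($h : L)), (algebraMap R L).rangeRestrict_surjective⟩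
  refine ⟨(e.symm : _ →+* R).comp (g.codRestrict _ hg), RingHom.ext fun o ↦ ?_⟩
  exact congr(($(e.apply_symm_apply ⟨g o, hg o⟩) : L))

section

variable {k K : Type*} [Field k] [Field K] [Algebra k K] {R L : Type*} [CommRing R] [IsDomain R]
  [Field L] [Algebra R L] [IsFractionRing R L]

omit [IsDomain R] in
-- Once `k` and `y` land in `R`, so does everything integral over `k[y]`, as `R` is integrally
-- closed.
theorem exists_comp_eq_of_integralClosureAdjoin [IsIntegrallyClosed R] {y : K}
    (g : integralClosureAdjoin k {y} →+* L)
    (hk : ∀ a : k, g (algebraMap k _ a) ∈ (algebraMap R L).range)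
    (hy : g ⟨y, subset_integralClosureAdjoin {y} rfl⟩ ∈ (algebraMap R L).range) :
    ∃ h : integralClosureAdjoin k {y} →+* R, (algebraMap R L).comp h = g := by
  refine exists_comp_eq_of_forall_mem_range (IsFractionRing.injective R L) g fun o ↦ ?_
  let j : Algebra.adjoin k {y} →+* integralClosureAdjoin k {y} :=
    algebraMap (Algebra.adjoin k {y}) (integralClosure (Algebra.adjoin k {y}) K)
  have hj (z : Algebra.adjoin k {y}) : g (j z) ∈ (algebraMap R L).range := by
    obtain ⟨z, hz⟩ := z
    induction hz using Algebra.adjoin_induction with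
    | mem z hz => obtain rfl := hz; exact hy
    | algebraMap a => exact hk a
    | add z w hz hw h1 h2 =>
      have : j ⟨z + w, add_mem hz hw⟩ = j ⟨z, hz⟩ + j ⟨w, hw⟩ := rfl
      rw [this, map_add]
      exact add_mem h1 h2
    | mul z w hz hw h1 h2 =>
      have : j ⟨z * w, mul_mem hz hw⟩ = j ⟨z, hz⟩ * j ⟨w, hw⟩ := rfl
      rw [this, map_mul]
      exact mul_mem h1 h2
  obtain ⟨h, hh⟩ := exists_comp_eq_of_forall_mem_range (IsFractionRing.injective R L) (g.comp j) hj
  have hint : j.IsIntegralElem o := by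
    obtain ⟨P, hP, hPo⟩ := o.2
    refine ⟨P, hP, Subtype.ext ?_⟩
    have : ((Polynomial.eval₂ j o P : integralClosureAdjoin k {y}) : K) = Polynomial.eval₂ (algebraMap _ K) (o : K) P := by
      exact Polynomial.hom_eval₂ P j (integralClosureAdjoin k {y}).val.toRingHom o
    rw [this, hPo]
    rfl
  obtain ⟨P, hP, hPo⟩ := hint
  have : IsIntegral R (g o) := by
    refine ⟨P.map h, hP.map _, ?_⟩
    rw [Polynomial.eval₂_map, hh, ← Polynomial.hom_eval₂, hPo, map_zero]
  exact IsIntegrallyClosed.isIntegral_iff.mp this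

/-- Valuative criterion for the curve glued from the integral closures of `k[y]` and `k[y⁻¹]`. -/
theorem exists_comp_eq_or_exists_comp_eq [ValuationRing R] {y z : K} (hyz : y * z = 1) {s : Set K}
    (hs : s = {y, z}) (hys : integralClosureAdjoin k {y} ≤ integralClosureAdjoin k s)
    (hzs : integralClosureAdjoin k {z} ≤ integralClosureAdjoin k s)
    (g : integralClosureAdjoin k {y} →+* L)
    (hk : ∀ a : k, g (algebraMap k _ a) ∈ (algebraMap R L).range) :
    (∃ h : integralClosureAdjoin k {y} →+* R, (algebraMap R L).comp h = g) ∨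
    ∃ (g' : integralClosureAdjoin k s →+* L) (h : integralClosureAdjoin k {z} →+* R),
      g'.comp (Subalgebra.inclusion hys).toRingHom = g ∧
      (algebraMap R L).comp h = g'.comp (Subalgebra.inclusion hzs).toRingHom := by
  have hy0 : y ≠ 0 := left_ne_zero_of_mul_eq_one hyz
  obtain rfl : z = y⁻¹ := eq_inv_of_mul_eq_one_right hyz
  let y' : integralClosureAdjoin k {y} := ⟨y, subset_integralClosureAdjoin {y} rfl⟩
  -- If `g y` is not in the valuation ring then its inverse is, so the map passes to the overlap and
  -- extends over the chart of `z = y⁻¹`.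
  by_cases hy : g y' ∈ (algebraMap R L).range
  · exact .inl (exists_comp_eq_of_integralClosureAdjoin g hk hy)
  right
  have hgy : g y' ≠ 0 := fun h ↦ hy (by rw [h]; exact zero_mem _)
  have hgy' : (g y')⁻¹ ∈ (algebraMap R L).range :=
    (ValuationRing.isInteger_or_isInteger R (g y')).resolve_left hy
  let _ := (Subalgebra.inclusion hys).toRingHom.toAlgebra
  have hloc := isLocalization_away_integralClosureAdjoin hy0 hs hys
  let g' : integralClosureAdjoin k s →+* L :=
    IsLocalization.Away.lift y' (g := g) hgy.isUnit
  have hg' : g'.comp (Subalgebra.inclusion hys).toRingHom = g :=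
    IsLocalization.Away.lift_comp y' (g := g) hgy.isUnit
  have hg'' (o) : g' (Subalgebra.inclusion hys o) = g o := RingHom.congr_fun hg' o
  clear_value g'
  have h1 (a : k) : g'.comp (Subalgebra.inclusion hzs).toRingHom (algebraMap k _ a) ∈
      (algebraMap R L).range := by
    have e : (Subalgebra.inclusion hzs).toRingHom (algebraMap k _ a) =
        Subalgebra.inclusion hys (algebraMap k _ a) :=
      ((Subalgebra.inclusion hzs).commutes a).trans ((Subalgebra.inclusion hys).commutes a).symm
    rw [RingHom.comp_apply, e, hg'']
    exact hk a
  have h2 : g' ⟨y⁻¹, hzs (subset_integralClosureAdjoin {y⁻¹} rfl)⟩ ∈ (algebraMap R L).range := by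
    have : g' ⟨y⁻¹, hzs (subset_integralClosureAdjoin {y⁻¹} rfl)⟩ = (g y')⁻¹ := by
      refine eq_inv_of_mul_eq_one_right ?_
      have e : Subalgebra.inclusion hys y' *
          ⟨y⁻¹, hzs (subset_integralClosureAdjoin {y⁻¹} rfl)⟩ = 1 :=
        Subtype.ext (mul_inv_cancel₀ hy0)
      rw [← hg'', ← map_mul, e, map_one]
    rw [this]
    exact hgy'
  obtain ⟨h, hh⟩ := exists_comp_eq_of_integralClosureAdjoin (R := R)
    (g'.comp (Subalgebra.inclusion hzs).toRingHom) h1 h2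
  exact ⟨g', h, hg', hh⟩

end

/-! ### Integrality of products of varieties. -/

namespace AlgebraicGeometry

theorem isIntegral_of_openCover {X : Scheme.{u}} (𝒰 : X.OpenCover) [Nonempty 𝒰.I₀]
    [∀ i, IsIntegral (𝒰.X i)] (h : ∀ i j, (Set.range (𝒰.f i) ∩ Set.range (𝒰.f j)).Nonempty) :
    IsIntegral X := by
  have : IsReduced X := IsReduced.of_openCover _ 𝒰
  have : Nonempty X := ⟨𝒰.f (Classical.arbitrary _) (Classical.arbitrary _)⟩
  have hirr (i) : IsPreirreducible (Set.range (𝒰.f i)) := by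
    rw [← Set.image_univ]
    exact (PreirreducibleSpace.isPreirreducible_univ).image _ (𝒰.f i).continuous.continuousOn
  have : PreirreducibleSpace X := by
    refine ⟨fun U V hU hV ⟨x, _, hx⟩ ⟨y, _, hy⟩ ↦ ?_⟩
    obtain ⟨i, x, rfl⟩ := 𝒰.exists_eq x
    obtain ⟨j, y, rfl⟩ := 𝒰.exists_eq y
    obtain ⟨z, hzi, hzj⟩ := h i j
    obtain ⟨w, -, hwU, hwj⟩ := hirr i U _ hU (𝒰.f j).isOpenEmbedding.isOpen_range
      ⟨_, ⟨x, rfl⟩, hx⟩ ⟨z, hzi, hzj⟩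
    obtain ⟨v, -, hv⟩ := hirr j U V hU hV ⟨w, hwj, hwU⟩ ⟨_, ⟨y, rfl⟩, hy⟩
    exact ⟨v, trivial, hv⟩
  have : IrreducibleSpace X := ⟨inferInstance⟩
  exact isIntegral_of_irreducibleSpace_of_isReduced X

theorem nonempty_affineCover_X {X : Scheme.{u}} (x : X.affineCover.I₀) :
    Nonempty (X.affineCover.X x) :=
  ⟨(X.local_affine x).choose_spec.choose_spec.some.hom.base ⟨x, (X.local_affine x).choose.2⟩⟩

/-- Products of affine charts are spectra of domains. They meet pairwise: charts of an irreducible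
factor meet, and any two points over the one-point base lift to the product. -/
theorem isIntegral_pullback_of_isAlgClosed {k : Type u} [Field k] [IsAlgClosed k] {X Y : Scheme.{u}}
    (f : X ⟶ Spec (.of k)) (g : Y ⟶ Spec (.of k)) [LocallyOfFiniteType f] [IsIntegral X]
    [IsIntegral Y] : IsIntegral (Limits.pullback f g) := by
  let 𝒰 := Scheme.Pullback.openCoverOfLeftRight X.affineCover Y.affineCover f g
  have : Nonempty 𝒰.I₀ := inferInstanceAs (Nonempty (X × Y))
  have hX (i : X.affineCover.I₀) : IsIntegral (X.affineCover.X i) :=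
    have : Nonempty (X.affineCover.X i) := nonempty_affineCover_X i
    isIntegral_of_isOpenImmersion (X.affineCover.f i)
  have hY (i : Y.affineCover.I₀) : IsIntegral (Y.affineCover.X i) :=
    have : Nonempty (Y.affineCover.X i) := nonempty_affineCover_X i
    isIntegral_of_isOpenImmersion (Y.affineCover.f i)
  have (i : 𝒰.I₀) : IsIntegral (𝒰.X i) := by
    obtain ⟨i, j⟩ := i
    have aux (A B : CommRingCat.{u}) (_ : IsIntegral (Spec A)) (_ : IsIntegral (Spec B))
        (a : Spec A ⟶ Spec (.of k)) (b : Spec B ⟶ Spec (.of k)) (_ : LocallyOfFiniteType a) :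
        IsIntegral (Limits.pullback a b) := by
      obtain ⟨a, rfl⟩ := Spec.map_surjective a
      obtain ⟨b, rfl⟩ := Spec.map_surjective b
      let _ : Algebra k A := a.hom.toAlgebra
      let _ : Algebra k B := b.hom.toAlgebra
      have : Algebra.FiniteType k A :=
        (HasRingHomProperty.Spec_iff (P := @LocallyOfFiniteType) (φ := a)).mp inferInstance
      have : IsDomain A := (affine_isIntegral_iff A).mp inferInstance
      have : IsDomain B := (affine_isIntegral_iff B).mp inferInstance
      have := TensorProduct.isDomain_of_isAlgClosed k A B
      exact .of_isIso (pullbackSpecIso k A B).inv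
    exact aux (X.affineOpenCover.X i) (Y.affineOpenCover.X j) (hX i) (hY j) (X.affineCover.f i ≫ f)
      (Y.affineCover.f j ≫ g) (inferInstanceAs (LocallyOfFiniteType (X.affineCover.f i ≫ f)))
  refine isIntegral_of_openCover 𝒰 fun ⟨i, j⟩ ⟨i', j'⟩ ↦ ?_
  have inter (Z : Scheme.{u}) [IsIntegral Z] (i j : Z.affineCover.I₀) :
      (Set.range (Z.affineCover.f i) ∩ Set.range (Z.affineCover.f j)).Nonempty :=
    have := nonempty_affineCover_X i
    have := nonempty_affineCover_X j
    nonempty_preirreducible_inter (Z.affineCover.f i).isOpenEmbedding.isOpen_range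
      (Z.affineCover.f j).isOpenEmbedding.isOpen_range (Set.range_nonempty _) (Set.range_nonempty _)
  have hr (i j) : Set.range (𝒰.f (i, j)) = Limits.pullback.fst f g ⁻¹' Set.range (X.affineCover.f i) ∩
      Limits.pullback.snd f g ⁻¹' Set.range (Y.affineCover.f j) :=
    Scheme.Pullback.range_map _ _ f g _ _ (𝟙 _) (Category.comp_id _) (Category.comp_id _)
  obtain ⟨x, hx, hx'⟩ := inter X i i'
  obtain ⟨y, hy, hy'⟩ := inter Y j j'
  obtain ⟨z, rfl, rfl⟩ := Scheme.Pullback.exists_preimage_pullback (f := f) (g := g) x y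
    (Subsingleton.elim (α := PrimeSpectrum k) _ _)
  exact ⟨z, (hr i j).ge ⟨hx, hy⟩, (hr i' j').ge ⟨hx', hy'⟩⟩

end AlgebraicGeometry

/-! ### The complete regular curve of a function field. -/

namespace AlgebraicGeometry

/-- `X` has an affine chart around `x` in which `x` is a closed point whose maximal ideal becomes
principal after localization. -/
def HasUniformizerAt {k : Type u} [Field k] {X : Scheme.{u}} (f : X ⟶ Spec (.of k)) (x : X) :
    Prop :=
  ∃ (B : Type u) (_ : CommRing B) (_ : Algebra k B) (i : Spec (.of B) ⟶ X) (m : PrimeSpectrum B),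
    Algebra.FiniteType k B ∧ IsOpenImmersion i ∧
    i ≫ f = Spec.map (CommRingCat.ofHom (algebraMap k B)) ∧ m.asIdeal.IsMaximal ∧ i m = x ∧
    ∃ π ∈ m.asIdeal, ∀ y ∈ m.asIdeal, ∃ s ∉ m.asIdeal, s * y ∈ Ideal.span {π}

/-- The open cover by two open immersions. -/
def openCoverOfPair {X U V : Scheme.{u}} (i : U ⟶ X) (j : V ⟶ X) [hi : IsOpenImmersion i]
    [hj : IsOpenImmersion j] (h : ∀ x : X, x ∈ Set.range i ∨ x ∈ Set.range j) :
    Scheme.OpenCover.{0} X where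
  I₀ := Bool
  X b := b.rec V U
  f b := b.rec j i
  mem₀ := by
    rw [Scheme.presieve₀_mem_precoverage_iff]
    refine ⟨fun c ↦ (h c).elim (fun h ↦ ⟨true, h⟩) (fun h ↦ ⟨false, h⟩), ?_⟩
    rintro (_ | _)
    · exact hj
    · exact hi

section

variable {k K : Type u} [Field k] [Field K] [Algebra k K]

theorem IntermediateField.adjoin_simple_inv (x : K) :
    IntermediateField.adjoin k {x⁻¹} = IntermediateField.adjoin k {x} := by
  apply le_antisymm <;> rw [IntermediateField.adjoin_simple_le_iff]
  · exact inv_mem (IntermediateField.mem_adjoin_simple_self k x)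
  · simpa using inv_mem (IntermediateField.mem_adjoin_simple_self k x⁻¹)

/-- The inclusion of the open subscheme `x ≠ 0`. -/
noncomputable def SpecMapInclusion {S T : Subalgebra k K} (h : S ≤ T) :
    Spec (.of T) ⟶ Spec (.of S) :=
  Spec.map (CommRingCat.ofHom (Subalgebra.inclusion h).toRingHom)

theorem SpecMapInclusion_algebraMap {S T : Subalgebra k K} (h : S ≤ T) :
    SpecMapInclusion h ≫ Spec.map (CommRingCat.ofHom (algebraMap k S)) =
      Spec.map (CommRingCat.ofHom (algebraMap k T)) := by
  rw [SpecMapInclusion, ← Spec.map_comp]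
  rfl

theorem isOpenImmersion_SpecMapInclusion {x : K} (hx : x ≠ 0) {s : Set K} (hs : s = {x, x⁻¹})
    (h : integralClosureAdjoin k {x} ≤ integralClosureAdjoin k s) :
    IsOpenImmersion (SpecMapInclusion h) := by
  let _ := (Subalgebra.inclusion h).toRingHom.toAlgebra
  have := isLocalization_away_integralClosureAdjoin hx hs h
  exact IsOpenImmersion.of_isLocalization
    (⟨x, subset_integralClosureAdjoin {x} rfl⟩ : integralClosureAdjoin k {x})

theorem exists_lift_of_charts {C : Scheme.{u}} (f : C ⟶ Spec (.of k)) {y z : K} (hyz : y * z = 1)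
    {s : Set K} (hs : s = {y, z}) (hys : integralClosureAdjoin k {y} ≤ integralClosureAdjoin k s)
    (hzs : integralClosureAdjoin k {z} ≤ integralClosureAdjoin k s)
    (i : Spec (.of (integralClosureAdjoin k {y})) ⟶ C) [IsOpenImmersion i]
    (j : Spec (.of (integralClosureAdjoin k {z})) ⟶ C)
    (hij : SpecMapInclusion hys ≫ i = SpecMapInclusion hzs ≫ j)
    (hi : i ≫ f = Spec.map (CommRingCat.ofHom (algebraMap k _)))
    (S : ValuativeCommSq f) (hS : Set.range S.i₁ ⊆ Set.range i) :
    ∃ l : Spec (.of S.R) ⟶ C,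
      Spec.map (CommRingCat.ofHom (algebraMap S.R S.K)) ≫ l = S.i₁ ∧ l ≫ f = S.i₂ := by
  -- Compatibility with the structure morphism is automatic, because `S.R` injects into `S.K` and
  -- the base is affine.
  suffices h : ∃ l : Spec (.of S.R) ⟶ C,
      Spec.map (CommRingCat.ofHom (algebraMap S.R S.K)) ≫ l = S.i₁ by
    obtain ⟨l, hl⟩ := h
    refine ⟨l, hl, ?_⟩
    have h : Spec.map (CommRingCat.ofHom (algebraMap S.R S.K)) ≫ l ≫ f =
        Spec.map (CommRingCat.ofHom (algebraMap S.R S.K)) ≫ S.i₂ := by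
      rw [reassoc_of% hl, S.commSq.w]
    obtain ⟨p, hp⟩ := Spec.map_surjective (l ≫ f)
    obtain ⟨q, hq⟩ := Spec.map_surjective S.i₂
    rw [← hp, ← hq, ← Spec.map_comp, ← Spec.map_comp] at h
    rw [← hp, ← hq]
    congr 1
    ext a
    exact IsFractionRing.injective S.R S.K congr($(Spec.map_injective h) a)
  obtain ⟨g, hg⟩ := Spec.map_surjective (IsOpenImmersion.lift i S.i₁ hS)
  have hgi : Spec.map g ≫ i = S.i₁ := by rw [hg, IsOpenImmersion.lift_fac]
  obtain ⟨q, hq⟩ := Spec.map_surjective S.i₂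
  have hk (a : k) : g.hom (algebraMap k _ a) ∈ (algebraMap S.R S.K).range := by
    have := S.commSq.w
    rw [← hgi, Category.assoc, hi, ← hq, ← Spec.map_comp, ← Spec.map_comp] at this
    exact ⟨q a, congr($(Spec.map_injective this) a).symm⟩
  obtain ⟨h, hh⟩ | ⟨g', h, hg', hh⟩ :=
    exists_comp_eq_or_exists_comp_eq (R := S.R) hyz hs hys hzs g.hom hk
  · refine ⟨Spec.map (CommRingCat.ofHom h) ≫ i, ?_⟩
    rw [← Spec.map_comp_assoc, ← CommRingCat.ofHom_comp, hh, CommRingCat.ofHom_hom, hgi]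
  · refine ⟨Spec.map (CommRingCat.ofHom h) ≫ j, ?_⟩
    rw [← Spec.map_comp_assoc, ← CommRingCat.ofHom_comp, hh, CommRingCat.ofHom_comp,
      Spec.map_comp_assoc, ← SpecMapInclusion, ← hij, SpecMapInclusion, ← Spec.map_comp_assoc,
      ← CommRingCat.ofHom_comp, hg', CommRingCat.ofHom_hom, hgi]

/-- The chart is the spectrum of a Dedekind domain: a prime is zero, giving the generic point, or
maximal with a local uniformizer. -/
theorem hasUniformizerAt_of_chart {C : Scheme.{u}} (f : C ⟶ Spec (.of k)) {y : K}
    [FiniteDimensional (IntermediateField.adjoin k {y}) K]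
    [Algebra.IsSeparable (IntermediateField.adjoin k {y}) K]
    (i : Spec (.of (integralClosureAdjoin k {y})) ⟶ C) [IsOpenImmersion i]
    (hi : i ≫ f = Spec.map (CommRingCat.ofHom (algebraMap k _)))
    [IsIntegral C] (c : C) (hc : c ∈ Set.range i) :
    (∀ U : C.Opens, (U : Set C).Nonempty → c ∈ U) ∨ HasUniformizerAt f c := by
  obtain ⟨p, rfl⟩ := hc
  by_cases hp : p.asIdeal = ⊥
  · left
    intro U hU
    obtain ⟨_, ⟨q, rfl⟩, hq⟩ := nonempty_preirreducible_inter
      i.isOpenEmbedding.isOpen_range U.isOpen ⟨_, ⟨p, rfl⟩⟩ hU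
    have : p ⤳ q := (PrimeSpectrum.le_iff_specializes p q).mp
      (show p.asIdeal ≤ q.asIdeal from hp ▸ bot_le)
    exact (this.map i.continuous).mem_open U.isOpen hq
  · have : p.asIdeal.IsPrime := PrimeSpectrum.isPrime p
    right
    exact ⟨_, _, _, i, p, inferInstance, ‹_›, hi, this.isMaximal hp, rfl,
      IsDedekindDomain.exists_mul_mem_span_of_ne_bot hp⟩

variable (k) in
-- Glue the spectra of the integral closures of `k[x]` and `k[x⁻¹]` along that of `k[x, x⁻¹]`.
-- Existence in the valuative criterion holds because a valuation ring contains `x` or `x⁻¹`.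
theorem exists_complete_curve {x : K} (hx : x ≠ 0)
    [FiniteDimensional (IntermediateField.adjoin k {x}) K]
    [Algebra.IsSeparable (IntermediateField.adjoin k {x}) K] :
    ∃ (C : Scheme.{u}) (f : C ⟶ Spec (.of k)) (i : Spec (.of (integralClosureAdjoin k {x})) ⟶ C),
      IsOpenImmersion i ∧ i ≫ f = Spec.map (CommRingCat.ofHom (algebraMap k _)) ∧
      IsIntegral C ∧ UniversallyClosed f ∧ LocallyOfFiniteType f ∧
      ∀ c : C, (∀ U : C.Opens, (U : Set C).Nonempty → c ∈ U) ∨ HasUniformizerAt f c := by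
  have hadj := IntermediateField.adjoin_simple_inv (k := k) x
  have : FiniteDimensional (IntermediateField.adjoin k {x⁻¹}) K := by rwa [hadj]
  have : Algebra.IsSeparable (IntermediateField.adjoin k {x⁻¹}) K := by rwa [hadj]
  have h1 : integralClosureAdjoin k {x} ≤ integralClosureAdjoin k {x, x⁻¹} :=
    integralClosureAdjoin_mono (by simp)
  have h2 : integralClosureAdjoin k {x⁻¹} ≤ integralClosureAdjoin k {x, x⁻¹} :=
    integralClosureAdjoin_mono (by simp)
  have := isOpenImmersion_SpecMapInclusion hx rfl h1
  have := isOpenImmersion_SpecMapInclusion (inv_ne_zero hx) (by rw [inv_inv, Set.pair_comm]) h2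
  let F := Limits.span (SpecMapInclusion h1) (SpecMapInclusion h2)
  let C := Limits.pushout (SpecMapInclusion h1) (SpecMapInclusion h2)
  let i : Spec (.of (integralClosureAdjoin k {x})) ⟶ C := Limits.pushout.inl _ _
  let j : Spec (.of (integralClosureAdjoin k {x⁻¹})) ⟶ C := Limits.pushout.inr _ _
  have hi : IsOpenImmersion i :=
    inferInstanceAs (IsOpenImmersion (Limits.colimit.ι F Limits.WalkingSpan.left))
  have hj : IsOpenImmersion j :=
    inferInstanceAs (IsOpenImmersion (Limits.colimit.ι F Limits.WalkingSpan.right))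
  have hij : SpecMapInclusion h1 ≫ i = SpecMapInclusion h2 ≫ j := Limits.pushout.condition
  have hsurj (c : C) : c ∈ Set.range i ∨ c ∈ Set.range j := by
    obtain ⟨(_ | _ | _), y, rfl⟩ := Scheme.IsLocallyDirected.ι_jointly_surjective F c
    · left
      have := Limits.colimit.w F Limits.WalkingSpan.Hom.fst
      exact ⟨SpecMapInclusion h1 y, congr($this y)⟩
    · exact .inl ⟨y, rfl⟩
    · exact .inr ⟨y, rfl⟩
  let f : C ⟶ Spec (.of k) := Limits.pushout.desc (Spec.map (CommRingCat.ofHom (algebraMap k _)))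
    (Spec.map (CommRingCat.ofHom (algebraMap k _)))
    (by rw [SpecMapInclusion_algebraMap, SpecMapInclusion_algebraMap])
  have hif : i ≫ f = Spec.map (CommRingCat.ofHom (algebraMap k _)) := Limits.pushout.inl_desc _ _ _
  have hjf : j ≫ f = Spec.map (CommRingCat.ofHom (algebraMap k _)) := Limits.pushout.inr_desc _ _ _
  clear_value f i j C
  let 𝒰 : Scheme.OpenCover.{0} C := openCoverOfPair i j hsurj
  have hC : IsIntegral C := by
    have : Nonempty 𝒰.I₀ := ⟨true⟩
    have (b : 𝒰.I₀) : IsIntegral (𝒰.X b) := by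
      rcases b with _ | _
      · exact inferInstanceAs (IsIntegral (Spec (.of (integralClosureAdjoin k {x⁻¹}))))
      · exact inferInstanceAs (IsIntegral (Spec (.of (integralClosureAdjoin k {x}))))
    let z : Spec (.of (integralClosureAdjoin k {x, x⁻¹})) := Classical.arbitrary _
    have hz (b : 𝒰.I₀) : ∃ y : 𝒰.X b, 𝒰.f b y = i (SpecMapInclusion h1 z) := by
      rcases b with _ | _
      · exact ⟨SpecMapInclusion h2 z, congr($hij.symm z)⟩
      · exact ⟨SpecMapInclusion h1 z, rfl⟩
    exact isIntegral_of_openCover 𝒰 fun b b' ↦ ⟨_, hz b, hz b'⟩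
  refine ⟨C, f, i, hi, hif, hC, ?_, ?_, fun c ↦ ?_⟩
  · have : QuasiCompact f := by
      have : CompactSpace C := by
        rw [← isCompact_univ_iff, show Set.univ = Set.range i ∪ Set.range j from
          (Set.eq_univ_of_forall hsurj).symm]
        exact (isCompact_range i.continuous).union (isCompact_range j.continuous)
      infer_instance
    refine .of_valuativeCriterion f fun S ↦ ?_
    let pt : Spec (.of S.K) := Classical.arbitrary _
    have hpt (q : Spec (.of S.K)) : q = pt := Subsingleton.elim (α := PrimeSpectrum S.K) _ _
    have hl : ∃ l : Spec (.of S.R) ⟶ C,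
        Spec.map (CommRingCat.ofHom (algebraMap S.R S.K)) ≫ l = S.i₁ ∧ l ≫ f = S.i₂ := by
      obtain h | h := hsurj (S.i₁ pt)
      · exact exists_lift_of_charts f (mul_inv_cancel₀ hx) rfl h1 h2 i j hij hif S
          (by rintro _ ⟨q, rfl⟩; rwa [hpt q])
      · exact exists_lift_of_charts f (inv_mul_cancel₀ hx) (Set.pair_comm _ _) h2 h1 j i hij.symm
          hjf S (by rintro _ ⟨q, rfl⟩; rwa [hpt q])
    obtain ⟨l, hl, hl'⟩ := hl
    exact ⟨⟨⟨l, hl, hl'⟩⟩⟩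
  · have (y : K) [FiniteDimensional (IntermediateField.adjoin k {y}) K]
        [Algebra.IsSeparable (IntermediateField.adjoin k {y}) K] : LocallyOfFiniteType
        (Spec.map (CommRingCat.ofHom (algebraMap k (integralClosureAdjoin k {y})))) := by
      rw [HasRingHomProperty.Spec_iff (P := @LocallyOfFiniteType), CommRingCat.hom_ofHom,
        RingHom.finiteType_algebraMap]
      infer_instance
    have hloc : IsZariskiLocalAtSource (@LocallyOfFiniteType.{u}) :=
      HasRingHomProperty.instIsZariskiLocalAtSource (Q := RingHom.FiniteType)
    refine (IsZariskiLocalAtSource.iff_of_openCover (P := @LocallyOfFiniteType.{u}) 𝒰).mpr ?_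
    rintro (_ | _)
    · change LocallyOfFiniteType (j ≫ f)
      rw [hjf]
      infer_instance
    · change LocallyOfFiniteType (i ≫ f)
      rw [hif]
      infer_instance
  · obtain h | h := hsurj c
    · exact hasUniformizerAt_of_chart f i hif c h
    · exact hasUniformizerAt_of_chart f j hjf c h

end

end AlgebraicGeometry

/-! ### Curves through a rational point of a variety. -/

namespace AlgebraicGeometry

open MonoidalCategory

variable {k : Type u} [Field k]

/-- The point of the underlying space given by a rational point. -/
noncomputable def pt {X : Over (Spec (.of k))} (x : 𝟙_ (Over (Spec (.of k))) ⟶ X) : X.left :=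
  x.left (IsLocalRing.closedPoint k)

theorem isClosed_pt [IsAlgClosed k] {X : Over (Spec (.of k))} [LocallyOfFiniteType X.hom]
    (x : 𝟙_ (Over (Spec (.of k))) ⟶ X) : IsClosed {pt x} :=
  (pointEquivClosedPoint X.hom ⟨x.left, Over.w x⟩).2

theorem exists_affine_chart {X : Over (Spec (.of k))} [IsIntegral X.left]
    [LocallyOfFiniteType X.hom] (x : X.left) :
    ∃ (B : Type u) (_ : CommRing B) (_ : Algebra k B) (i : Spec (.of B) ⟶ X.left)
      (m : PrimeSpectrum B), IsDomain B ∧ Algebra.FiniteType k B ∧ IsOpenImmersion i ∧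
      i ≫ X.hom = Spec.map (CommRingCat.ofHom (algebraMap k B)) ∧ i m = x := by
  obtain ⟨R, i, _, ⟨m, hm⟩, _⟩ : ∃ (R : CommRingCat.{u}) (f : Spec R ⟶ X.left),
      IsOpenImmersion f ∧ (∃ m, f m = x) ∧ True :=
    ⟨_, X.left.affineOpenCover.f _, inferInstance, X.left.affineOpenCover.covers x, trivial⟩
  obtain ⟨φ, hφ⟩ := Spec.map_surjective (i ≫ X.hom)
  let _ : Algebra k R := φ.hom.toAlgebra
  have : Nonempty (Spec R) := ⟨m⟩
  have : IsIntegral (Spec R) := isIntegral_of_isOpenImmersion i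
  refine ⟨R, inferInstance, inferInstance, i, m, (affine_isIntegral_iff R).mp inferInstance, ?_,
    ‹_›, hφ.symm, hm⟩
  have : LocallyOfFiniteType (Spec.map φ) := by rw [hφ]; infer_instance
  exact (HasRingHomProperty.Spec_iff (P := @LocallyOfFiniteType) (φ := φ)).mp this

theorem exists_curve [IsAlgClosed k] {X : Over (Spec (.of k))} [IsIntegral X.left]
    [LocallyOfFiniteType X.hom] (x₀ : 𝟙_ _ ⟶ X) {Z : Set X.left} (hZ : IsClosed Z)
    (hZ' : Z ≠ Set.univ) (hx₀ : pt x₀ ∈ Z) :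
    ∃ (C D : Over (Spec (.of k))) (j : D ⟶ C) (f : D ⟶ X) (c₀ : 𝟙_ _ ⟶ D),
      IsIntegral C.left ∧ UniversallyClosed C.hom ∧ LocallyOfFiniteType C.hom ∧
      IsOpenImmersion j.left ∧ c₀ ≫ f = x₀ ∧ ¬ Set.range f.left ⊆ Z ∧
      ∀ c : C.left, (∀ U : C.left.Opens, (U : Set C.left).Nonempty → c ∈ U) ∨
        HasUniformizerAt C.hom c := by
  obtain ⟨B, _, _, i, m, _, _, _, hi, hm⟩ := exists_affine_chart (pt x₀)
  have hmax : m.asIdeal.IsMaximal := by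
    rw [← PrimeSpectrum.isClosed_singleton_iff_isMaximal]
    have h : i ⁻¹' {pt x₀} = {m} := Set.ext fun q ↦
      ⟨fun hq ↦ i.isOpenEmbedding.injective ((Set.mem_singleton_iff.mp hq).trans hm.symm),
        fun hq ↦ (congrArg i hq).trans hm⟩
    exact h ▸ (isClosed_pt x₀).preimage i.continuous
  obtain ⟨s, hs⟩ := (PrimeSpectrum.isClosed_iff_zeroLocus _).mp (hZ.preimage i.continuous)
  obtain ⟨_, hpZ, p, rfl⟩ : (Zᶜ ∩ Set.range i).Nonempty :=
    nonempty_preirreducible_inter hZ.isOpen_compl i.isOpenEmbedding.isOpen_range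
      (Set.nonempty_compl.mpr hZ') ⟨_, ⟨m, rfl⟩⟩
  obtain ⟨f, hfs, hfp⟩ : ∃ f ∈ s, f ∉ p.asIdeal := by
    by_contra! h
    have : p ∈ PrimeSpectrum.zeroLocus s := h
    exact hpZ (hs.ge this)
  have hfm : f ∈ m.asIdeal := by
    have : m ∈ PrimeSpectrum.zeroLocus s := hs.le (show i m ∈ Z from hm ▸ hx₀)
    exact this hfs
  have hf0 : f ≠ 0 := by rintro rfl; exact hfp (zero_mem _)
  obtain ⟨K, _, _, x, hx, _, _, T, hT, t, h, n, hloc, hn, hnm, hhf⟩ :=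
    exists_algHom_isLocalization_away (k := k) m.asIdeal hf0 hfm
  obtain ⟨C, g, j, _, hj, hC1, hC2, hC3, hC⟩ := exists_complete_curve k hx
  have : IsOpenImmersion (SpecMapInclusion hT) := by
    let _ := (Subalgebra.inclusion hT).toRingHom.toAlgebra
    have : IsLocalization.Away t T := hloc
    exact IsOpenImmersion.of_isLocalization t
  let D : Over (Spec (.of k)) := Over.mk (Spec.map (CommRingCat.ofHom (algebraMap k T)))
  let u : Spec (.of T) ⟶ Spec (.of B) := Spec.map (CommRingCat.ofHom h.toRingHom)
  let N : PrimeSpectrum T := ⟨n, hn.isPrime⟩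
  have huN : u N = m := PrimeSpectrum.ext hnm
  have hu : (u ≫ i) ≫ X.hom = D.hom := by
    rw [Category.assoc, hi, ← Spec.map_comp, ← CommRingCat.ofHom_comp]
    congr 2
    exact h.comp_algebraMap
  have hft : Algebra.FiniteType k T := by
    let _ := (Subalgebra.inclusion hT).toRingHom.toAlgebra
    have : IsLocalization.Away t T := hloc
    have : IsScalarTower k (integralClosureAdjoin k {x}) T := .of_algebraMap_eq fun _ ↦ rfl
    have : Algebra.FinitePresentation (integralClosureAdjoin k {x}) T :=
      IsLocalization.Away.finitePresentation t
    exact .trans (S := integralClosureAdjoin k {x}) inferInstance inferInstance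
  have : LocallyOfFiniteType D.hom :=
    (HasRingHomProperty.Spec_iff (P := @LocallyOfFiniteType)).mpr
      ((RingHom.finiteType_algebraMap (A := k) (B := T)).mpr hft)
  have hN : IsClosed {(N : D.left)} := (PrimeSpectrum.isClosed_singleton_iff_isMaximal N).mpr hn
  refine ⟨Over.mk g, D, Over.homMk (SpecMapInclusion hT ≫ j) ?_, Over.homMk (u ≫ i) hu,
    Over.homMk (pointOfClosedPoint D.hom N hN) (pointOfClosedPoint_comp ..), hC1, hC2, hC3, ?_, ?_,
    fun hZ ↦ ?_, hC⟩
  · rw [Category.assoc]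
    change SpecMapInclusion hT ≫ j ≫ g = _
    rw [hj, SpecMapInclusion_algebraMap]
    rfl
  · change IsOpenImmersion (SpecMapInclusion hT ≫ j)
    infer_instance
  · ext1
    refine ext_of_apply_closedPoint_eq X.hom (Over.w _) (Over.w _) ?_
    have := pointOfClosedPoint_apply D.hom N hN (IsLocalRing.closedPoint k)
    exact (congrArg (fun y ↦ i (u y)) this).trans ((congrArg i huN).trans hm)
  -- The generic point of the curve leaves `Z`, because `f` vanishes on `Z` in the chart but `h f ≠
  -- 0`.
  · let b : PrimeSpectrum T := ⟨⊥, Ideal.isPrime_bot⟩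
    have : u b ∈ PrimeSpectrum.zeroLocus s := hs.le (hZ ⟨b, rfl⟩)
    exact hhf (this hfs)

end AlgebraicGeometry

/-! ### Extending maps into a proper scheme. -/

/-- The image of `π` generates the maximal ideal, and a Noetherian local domain with principal
maximal ideal is a field or a discrete valuation ring. -/
theorem IsLocalization.AtPrime.valuationRing_of_forall_mul_mem_span {R : Type*} (S : Type*)
    [CommRing R] [IsNoetherianRing R] [CommRing S] [IsDomain S] [Algebra R S] (q : Ideal R)
    [q.IsPrime] [IsLocalization.AtPrime S q] {π : R} (hπ : π ∈ q)
    (h : ∀ x ∈ q, ∃ s ∉ q, s * x ∈ Ideal.span {π}) : ValuationRing S := by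
  have : IsLocalRing S := IsLocalization.AtPrime.isLocalRing S q
  have : IsNoetherianRing S := IsLocalization.isNoetherianRing q.primeCompl S inferInstance
  have hm : (IsLocalRing.maximalIdeal S).IsPrincipal := by
    refine ⟨algebraMap R S π, le_antisymm (fun x hx ↦ ?_) ?_⟩
    · obtain ⟨a, t, rfl⟩ := IsLocalization.exists_mk'_eq q.primeCompl x
      obtain ⟨s, hs, hsa⟩ := h a ((IsLocalization.AtPrime.mk'_mem_maximal_iff S q a t).mp hx)
      obtain ⟨b, hb⟩ := Ideal.mem_span_singleton.mp hsa
      refine Ideal.mem_span_singleton.mpr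
        ⟨IsLocalization.mk' S b ((⟨s, hs⟩ : q.primeCompl) * t), ?_⟩
      rw [IsLocalization.mul_mk'_eq_mk'_of_mul, ← hb]
      exact IsLocalization.mk'_eq_of_eq (by push_cast; ring)
    · rw [Ideal.submodule_span_eq, Ideal.span_singleton_le_iff_mem]
      exact (IsLocalization.AtPrime.to_map_mem_maximal_iff S q π).mpr hπ
  exact ((tfae_of_isNoetherianRing_of_isLocalRing_of_isDomain S).out 4 1).mp hm

namespace AlgebraicGeometry

theorem Scheme.PartialMap.map_stalkSpecializes_fromSpecStalkOfMem {X Y : Scheme.{u}}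
    (f : X.PartialMap Y) {x y : X} (h : x ⤳ y) (hx : x ∈ f.domain) (hy : y ∈ f.domain) :
    Spec.map (X.presheaf.stalkSpecializes h) ≫ f.fromSpecStalkOfMem hy =
      f.fromSpecStalkOfMem hx := by
  rw [fromSpecStalkOfMem, fromSpecStalkOfMem, ← Category.assoc]
  congr 1
  rw [← cancel_mono f.domain.ι, Category.assoc, Opens.fromSpecStalkOfMem_ι,
    Opens.fromSpecStalkOfMem_ι, SpecMap_stalkSpecializes_fromSpecStalk]

theorem exists_lift_of_isProper {X Y : Scheme.{u}} (f : X ⟶ Y) [hf : IsProper f] {R K : Type u}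
    [CommRing R] [IsDomain R] [ValuationRing R] [Field K] [Algebra R K] [IsFractionRing R K]
    (i₁ : Spec (.of K) ⟶ X) (i₂ : Spec (.of R) ⟶ Y)
    (w : i₁ ≫ f = Spec.map (CommRingCat.ofHom (algebraMap R K)) ≫ i₂) :
    ∃ l : Spec (.of R) ⟶ X,
      Spec.map (CommRingCat.ofHom (algebraMap R K)) ≫ l = i₁ ∧ l ≫ f = i₂ := by
  rw [IsProper.eq_valuativeCriterion] at hf
  obtain ⟨⟨l, hl, hl'⟩⟩ := (hf.1.1.1.existence ⟨R, K, i₁, i₂, ⟨w⟩⟩).exists_lift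
  exact ⟨l, hl, hl'⟩

/-- The valuative criterion extends the map from the function field to the spectrum of the stalk. It
then spreads out to a neighbourhood of `p`, where it represents the same rational map. -/
theorem mem_domain_of_valuationRing {P A S : Scheme.{u}} [IsIntegral P] (sP : P ⟶ S) (sA : A ⟶ S)
    [IsProper sA] (g : P.PartialMap A) (hg : g.hom ≫ sA = g.domain.ι ≫ sP) (p : P)
    [ValuationRing (P.presheaf.stalk p)] : p ∈ g.toRationalMap.domain := by
  have hgen (q : P) : genericPoint P ⤳ q := (genericPoint_spec P).specializes trivial
  have w : g.fromFunctionField ≫ sA = Spec.map (CommRingCat.ofHom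
      (algebraMap (P.presheaf.stalk p) P.functionField)) ≫ P.fromSpecStalk p ≫ sP := by
    rw [Scheme.PartialMap.fromFunctionField, Scheme.PartialMap.fromSpecStalkOfMem, Category.assoc,
      hg, Scheme.Opens.fromSpecStalkOfMem_ι_assoc,
      ← Scheme.SpecMap_stalkSpecializes_fromSpecStalk (hgen p), Category.assoc]
    rfl
  have key := exists_lift_of_isProper sA (R := P.presheaf.stalk p) (K := P.functionField)
  obtain ⟨φ, hφ, hφ'⟩ := key g.fromFunctionField (P.fromSpecStalk p ≫ sP) w
  let f := Scheme.PartialMap.ofFromSpecStalk sP sA φ hφ'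
  have hpf : p ∈ f.domain := Scheme.PartialMap.mem_domain_ofFromSpecStalk ..
  refine Scheme.RationalMap.mem_domain.mpr ⟨f, hpf, ?_⟩
  refine Scheme.RationalMap.eq_of_fromFunctionField_eq _ _ ?_
  rw [Scheme.RationalMap.fromFunctionField_toRationalMap,
    Scheme.RationalMap.fromFunctionField_toRationalMap]
  refine Eq.trans ?_ hφ
  rw [Scheme.PartialMap.fromFunctionField,
    ← f.map_stalkSpecializes_fromSpecStalkOfMem (hgen p) _ hpf]
  congr 1
  exact Scheme.PartialMap.fromSpecStalkOfMem_ofFromSpecStalk ..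

theorem valuationRing_stalk_of_isOpenImmersion {X Y : Scheme.{u}} (f : X ⟶ Y) [IsOpenImmersion f]
    [IsIntegral X] [IsIntegral Y] (x : X) [ValuationRing (X.presheaf.stalk x)] :
    ValuationRing (Y.presheaf.stalk (f x)) := by
  let e := (asIso (f.stalkMap x)).commRingCatIsoToRingEquiv.symm
  have : PreValuationRing (Y.presheaf.stalk (f x)) :=
    Function.Surjective.preValuationRing (e : X.presheaf.stalk x →ₙ* Y.presheaf.stalk (f x))
      e.surjective
  exact ⟨⟩

theorem valuationRing_stalk_Spec {R : CommRingCat.{u}} [IsNoetherianRing R] [IsDomain R]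
    (q : Spec R) {π : R} (hπ : π ∈ q.asIdeal)
    (h : ∀ x ∈ q.asIdeal, ∃ s ∉ q.asIdeal, s * x ∈ Ideal.span {π}) :
    ValuationRing ((Spec R).presheaf.stalk q) :=
  have : q.asIdeal.IsPrime := PrimeSpectrum.isPrime q
  let _ : Algebra R ((Spec R).presheaf.stalk q) := StructureSheaf.stalkAlgebra R q
  have : IsLocalization.AtPrime ((Spec R).presheaf.stalk q) q.asIdeal :=
    StructureSheaf.IsLocalization.to_stalk R q
  IsLocalization.AtPrime.valuationRing_of_forall_mul_mem_span _ q.asIdeal hπ h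

end AlgebraicGeometry

namespace AlgebraicGeometry

open MonoidalCategory CartesianMonoidalCategory TensorProduct

variable {k : Type u} [Field k]

instance {C C' Y : Over (Spec (.of k))} (f : C ⟶ C') [IsOpenImmersion f.left] :
    IsOpenImmersion (f ▷ Y).left := by
  rw [Over.whiskerRight_left]
  infer_instance

theorem isIntegral_tensorObj [IsAlgClosed k] (X Y : Over (Spec (.of k)))
    [LocallyOfFiniteType X.hom] [IsIntegral X.left] [IsIntegral Y.left] :
    IsIntegral (X ⊗ Y).left :=
  isIntegral_pullback_of_isAlgClosed X.hom Y.hom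

/-- In a chart `B ⊗ R`, the point `p` is a prime over `m` and over zero, so a uniformizer of `m` is
one for it as well. -/
theorem valuationRing_stalk_tensorObj [IsAlgClosed k] {C Y : Over (Spec (.of k))}
    [LocallyOfFiniteType C.hom] [LocallyOfFiniteType Y.hom] [IsIntegral C.left] [IsIntegral Y.left]
    [IsIntegral (C ⊗ Y).left] (p : (C ⊗ Y).left) (hp : HasUniformizerAt C.hom ((fst C Y).left p))
    (hp' : (snd C Y).left p = genericPoint Y.left) :
    ValuationRing ((C ⊗ Y).left.presheaf.stalk p) := by
  obtain ⟨B, _, _, i, m, _, _, hi, hm, him, π, hπ, hπm⟩ := hp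
  obtain ⟨R, _, _, i', m', _, _, _, hi', him'⟩ := exists_affine_chart ((snd C Y).left p)
  have : Nonempty (Spec (.of B)) := ⟨m⟩
  have hB : IsIntegral (Spec (.of B)) := isIntegral_of_isOpenImmersion i
  have : IsDomain B := (affine_isIntegral_iff (.of B)).mp hB
  have := TensorProduct.isDomain_of_isAlgClosed k B R
  have : Algebra.FiniteType k (B ⊗[k] R) :=
    .trans (S := B) inferInstance (Algebra.FiniteType.baseChange B)
  have : IsNoetherianRing (B ⊗[k] R) := Algebra.FiniteType.isNoetherianRing k _
  let a : Limits.pullback (Spec.map (CommRingCat.ofHom (algebraMap k B)))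
      (Spec.map (CommRingCat.ofHom (algebraMap k R))) ⟶ (C ⊗ Y).left :=
    Limits.pullback.map _ _ C.hom Y.hom i i' (𝟙 _) (by rw [hi, Category.comp_id])
      (by rw [hi', Category.comp_id])
  have ha : IsOpenImmersion a := inferInstanceAs (IsOpenImmersion (Limits.pullback.map ..))
  let e := (pullbackSpecIso k B R).inv ≫ a
  have he1 : e ≫ (fst C Y).left =
      Spec.map (CommRingCat.ofHom Algebra.TensorProduct.includeLeftRingHom) ≫ i := by
    rw [Category.assoc, ← pullbackSpecIso_inv_fst_assoc]
    congr 1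
    exact Limits.pullback.lift_fst ..
  have he2 : e ≫ (snd C Y).left = Spec.map (CommRingCat.ofHom
      (Algebra.TensorProduct.includeRight (R := k) (A := B) (B := R) : R →+* B ⊗[k] R)) ≫ i' := by
    rw [Category.assoc, ← pullbackSpecIso_inv_snd_assoc]
    congr 1
    exact Limits.pullback.lift_snd ..
  obtain ⟨q, rfl⟩ : p ∈ Set.range e := by
    have : p ∈ Set.range a := (Scheme.Pullback.range_map ..).ge ⟨⟨m, him⟩, ⟨m', him'⟩⟩
    obtain ⟨r, rfl⟩ := this
    exact ⟨(pullbackSpecIso k B R).hom r, by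
      rw [← Scheme.Hom.comp_apply, Iso.hom_inv_id_assoc]⟩
  have hq := i.isOpenEmbedding.injective (him.trans congr($he1 q))
  have hgen : i' (genericPoint _) = genericPoint Y.left := genericPoint_eq_of_isOpenImmersion i'
  have hq' := i'.isOpenEmbedding.injective ((hgen.trans hp'.symm).trans congr($he2 q))
  rw [genericPoint_eq_bot_of_affine] at hq'
  have : q.asIdeal.IsPrime := PrimeSpectrum.isPrime q
  obtain ⟨h1, h2⟩ := TensorProduct.exists_mul_mem_span_of_comap_eq_bot m.asIdeal π hπ hπm q.asIdeal
    (congrArg PrimeSpectrum.asIdeal hq.symm) (congrArg PrimeSpectrum.asIdeal hq'.symm)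
  have := valuationRing_stalk_Spec (R := .of (B ⊗[k] R)) q h1 h2
  exact valuationRing_stalk_of_isOpenImmersion e q

end AlgebraicGeometry

namespace AlgebraicGeometry

open MonoidalCategory CartesianMonoidalCategory

variable {k : Type u} [Field k]

instance {X Y : Over (Spec (.of k))} [UniversallyClosed X.hom] :
    UniversallyClosed (snd X Y).left :=
  inferInstanceAs (UniversallyClosed (Limits.pullback.snd X.hom Y.hom))

theorem range_whiskerRight_left {C D Y : Over (Spec (.of k))} (j : D ⟶ C) :
    Set.range (j ▷ Y).left = (fst C Y).left ⁻¹' Set.range j.left := by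
  refine (Scheme.Pullback.range_map D.hom Y.hom C.hom Y.hom j.left (𝟙 _) (𝟙 _)
    (by simp) (by simp)).trans ?_
  exact Set.inter_eq_left.mpr fun _ _ ↦ ⟨_, rfl⟩

theorem exists_extension_of_hasUniformizerAt [IsAlgClosed k] {C D Y A : Over (Spec (.of k))}
    [LocallyOfFiniteType C.hom] [LocallyOfFiniteType Y.hom] [IsIntegral C.left] [IsIntegral Y.left]
    [UniversallyClosed C.hom] [IsProper A.hom] (j : D ⟶ C) [IsOpenImmersion j.left]
    [Nonempty D.left] (hC : ∀ c : C.left,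
      (∀ U : C.left.Opens, (U : Set C.left).Nonempty → c ∈ U) ∨ HasUniformizerAt C.hom c)
    (F : D ⊗ Y ⟶ A) :
    ∃ (U : Over (Spec (.of k))) (u : U ⟶ Y) (F' : C ⊗ U ⟶ A), IsOpenImmersion u.left ∧
      Nonempty U.left ∧ j ▷ U ≫ F' = D ◁ u ≫ F := by
  have hP : IsIntegral (C ⊗ Y).left := isIntegral_tensorObj C Y
  let P := (C ⊗ Y).left
  have hDY : Nonempty (D ⊗ Y).left := by
    obtain ⟨z, -⟩ := Scheme.Pullback.exists_preimage_pullback (f := D.hom) (g := Y.hom)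
      (Classical.arbitrary D.left) (Classical.arbitrary Y.left)
      (Subsingleton.elim (α := PrimeSpectrum k) _ _)
    exact ⟨z⟩
  let g : P.PartialMap A.left :=
    { domain := (j ▷ Y).left.opensRange
      dense_domain := (j ▷ Y).left.opensRange.isOpen.dense (Set.range_nonempty (j ▷ Y).left)
      hom := (j ▷ Y).left.isoOpensRange.inv ≫ F.left }
  have hg : g.hom ≫ A.hom = g.domain.ι ≫ (C ⊗ Y).hom := by
    rw [← cancel_epi (j ▷ Y).left.isoOpensRange.hom, Scheme.Hom.isoOpensRange_hom_ι_assoc,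
      Over.w (j ▷ Y), Category.assoc, Iso.hom_inv_id_assoc, Over.w F]
  have hsep : A.left.IsSeparated := by
    have : IsSeparated (A.hom ≫ Limits.terminal.from _) := inferInstance
    rw [Limits.terminal.hom_ext (A.hom ≫ Limits.terminal.from _) (Limits.terminal.from _)] at this
    exact ⟨this⟩
  let W := g.toRationalMap.domain
  let G : W.toScheme ⟶ A.left := g.toRationalMap.toPartialMap.hom
  have hW : g.domain ≤ W := g.le_domain_toRationalMap
  have hG : P.homOfLE hW ≫ G = g.hom := g.toPartialMap_toRationalMap_restrict
  have hGA : G ≫ A.hom = W.ι ≫ (C ⊗ Y).hom := by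
    have : IsDominant (P.homOfLE hW) := Opens.isDominant_homOfLE g.dense_domain _
    refine ext_of_isDominant (P.homOfLE hW) ?_
    rw [reassoc_of% hG, hg, Scheme.homOfLE_ι_assoc]
  -- The locus where the extended map is undefined has closed image in `Y`, which misses the generic
  -- point: over that point, `p` lies in `D × Y` or has a valuation ring as stalk.
  have hclosed : IsClosed ((snd C Y).left '' (W : Set P)ᶜ) :=
    (snd C Y).left.isClosedMap _ W.isOpen.isClosed_compl
  let V : Y.left.Opens := ⟨_, hclosed.isOpen_compl⟩
  have hV : genericPoint Y.left ∈ V := by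
    rintro ⟨p, hpW, hp⟩
    apply hpW
    obtain h | h := hC ((fst C Y).left p)
    · obtain ⟨d, hd⟩ := h j.left.opensRange (Set.range_nonempty j.left)
      exact hW ((range_whiskerRight_left j).ge ⟨d, hd⟩)
    · have := valuationRing_stalk_tensorObj p h hp
      exact mem_domain_of_valuationRing (C ⊗ Y).hom A.hom g hg p
  let U : Over (Spec (.of k)) := Over.mk (V.ι ≫ Y.hom)
  let u : U ⟶ Y := Over.homMk V.ι rfl
  have hu : Set.range (C ◁ u).left ⊆ Set.range W.ι := by
    rintro _ ⟨z, rfl⟩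
    rw [Scheme.Opens.range_ι]
    by_contra h
    have : (snd C Y).left ((C ◁ u).left z) ∈ V := by
      have e : (C ◁ u).left ≫ (snd C Y).left = (snd C U).left ≫ V.ι := Over.whiskerLeft_left_snd ..
      rw [← Scheme.Hom.comp_apply, e]
      exact ((snd C U).left z).2
    exact this ⟨_, h, rfl⟩
  let l := IsOpenImmersion.lift W.ι (C ◁ u).left hu
  have hl : l ≫ W.ι = (C ◁ u).left := IsOpenImmersion.lift_fac ..
  refine ⟨U, u, Over.homMk (l ≫ G) ?_, inferInstanceAs (IsOpenImmersion V.ι), ⟨⟨_, hV⟩⟩, ?_⟩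
  · rw [Category.assoc, hGA, reassoc_of% hl, Over.w]
  · ext1
    change (j ▷ U).left ≫ l ≫ G = (D ◁ u).left ≫ F.left
    have h1 : (j ▷ U).left ≫ l = (D ◁ u).left ≫ (j ▷ Y).left.isoOpensRange.hom ≫ P.homOfLE hW := by
      rw [← cancel_mono W.ι, Category.assoc, Category.assoc, Category.assoc, hl,
        Scheme.homOfLE_ι, Scheme.Hom.isoOpensRange_hom_ι, ← Over.comp_left, ← Over.comp_left,
        whisker_exchange]
    rw [reassoc_of% h1, hG, Iso.hom_inv_id_assoc]

end AlgebraicGeometry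

/-! ### The rigidity lemma. -/

namespace AlgebraicGeometry

open MonoidalCategory CartesianMonoidalCategory

variable {k : Type u} [Field k]

/-- A map to an affine scheme factors through the spectrum of the global sections, which form a
field here. -/
theorem apply_eq_apply_of_universallyClosed {C W : Scheme.{u}} [IsIntegral C]
    (f : C ⟶ Spec (.of k)) [UniversallyClosed f] [IsAffine W] (h : C ⟶ W) (c d : C) :
    h c = h d := by
  have hf : IsField Γ(C, ⊤) := isField_of_universallyClosed k f
  have : Subsingleton (Spec Γ(C, ⊤)) := by
    let := hf.toField
    exact inferInstanceAs (Subsingleton (PrimeSpectrum Γ(C, ⊤)))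
  apply W.isoSpec.hom.isOpenEmbedding.injective
  have e : h ≫ W.isoSpec.hom = C.toSpecΓ ≫ Spec.map h.appTop := by
    rw [Scheme.isoSpec_hom, Scheme.toSpecΓ_naturality]
  rw [← Scheme.Hom.comp_apply, ← Scheme.Hom.comp_apply, e, Scheme.Hom.comp_apply,
    Scheme.Hom.comp_apply]
  congr 1
  exact Subsingleton.elim _ _

theorem range_whiskerLeft_left {C D Y : Over (Spec (.of k))} (j : D ⟶ C) :
    Set.range (Y ◁ j).left = (snd Y C).left ⁻¹' Set.range j.left := by
  refine (Scheme.Pullback.range_map Y.hom D.hom Y.hom C.hom (𝟙 _) j.left (𝟙 _)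
    (by simp) (by simp)).trans ?_
  exact Set.inter_eq_right.mpr fun _ _ ↦ ⟨_, rfl⟩

theorem comp_left_apply {X Y Z : Over (Spec (.of k))} (f : X ⟶ Y) (g : Y ⟶ Z) (x : X.left) :
    (f ≫ g).left x = g.left (f.left x) := rfl

theorem left_apply_eq_pt {X : Over (Spec (.of k))} (x : 𝟙_ (Over (Spec (.of k))) ⟶ X)
    (z : (𝟙_ (Over (Spec (.of k)))).left) : x.left z = pt x := by
  rw [pt]
  congr 1
  exact Subsingleton.elim (α := PrimeSpectrum k) _ _

theorem exists_pt_eq [IsAlgClosed k] {X : Over (Spec (.of k))} [LocallyOfFiniteType X.hom]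
    {x : X.left} (hx : IsClosed {x}) : ∃ y : 𝟙_ (Over (Spec (.of k))) ⟶ X, pt y = x :=
  ⟨Over.homMk (pointOfClosedPoint X.hom x hx) (pointOfClosedPoint_comp ..),
    pointOfClosedPoint_apply ..⟩

/-- Take an affine neighbourhood `W` of `a`. As `C` is universally closed, the fibres `C × {y}` that
`H` sends into `W` are those over an open `V` containing `u`. On each such fibre over a closed point
`H` is constant on points, so both sides agree on closed points of a dense open set; `C × U` is
integral and `A` is separated. -/
theorem eq_comp_of_whiskerLeft_eq [IsAlgClosed k] {C U A : Over (Spec (.of k))}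
    [LocallyOfFiniteType C.hom] [LocallyOfFiniteType U.hom] [IsIntegral C.left] [IsIntegral U.left]
    [UniversallyClosed C.hom] [IsSeparated A.hom] [LocallyOfFiniteType A.hom] (H : C ⊗ U ⟶ A)
    (u : 𝟙_ _ ⟶ U) (a : 𝟙_ _ ⟶ A) (hu : C ◁ u ≫ H = toUnit _ ≫ a) (c₀ : 𝟙_ _ ⟶ C) :
    H = lift (toUnit _ ≫ c₀) (snd C U) ≫ H := by
  have hP : IsIntegral (C ⊗ U).left := isIntegral_tensorObj C U
  obtain ⟨W', ⟨W, hW, hWW'⟩, haW, -⟩ := A.left.isBasis_affineOpens.exists_subset_of_mem_open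
    (Set.mem_univ (pt a)) isOpen_univ
  subst hWW'
  let W : A.left.Opens := W
  have : IsAffine W := hW
  have hclosed : IsClosed ((snd C U).left '' (H.left ⁻¹ᵁ W : Set (C ⊗ U).left)ᶜ) :=
    (snd C U).left.isClosedMap _ (H.left ⁻¹ᵁ W).isOpen.isClosed_compl
  let V : U.left.Opens := ⟨_, hclosed.isOpen_compl⟩
  have hVW (p) (hp : (snd C U).left p ∈ V) : H.left p ∈ W := by
    by_contra h
    exact hp ⟨p, h, rfl⟩
  have huV : pt u ∈ V := by
    rintro ⟨p, hpW, hp⟩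
    obtain ⟨q, rfl⟩ := (range_whiskerLeft_left u).ge ⟨IsLocalRing.closedPoint k, hp.symm⟩
    apply hpW
    change H.left ((C ◁ u).left q) ∈ W
    rw [← comp_left_apply, hu, comp_left_apply, left_apply_eq_pt]
    exact haW
  have hne : ((snd C U).left ⁻¹ᵁ V : Set (C ⊗ U).left).Nonempty := by
    obtain ⟨z, -, hz⟩ := Scheme.Pullback.exists_preimage_pullback (f := C.hom) (g := U.hom)
      (pt c₀) (pt u) (Subsingleton.elim (α := PrimeSpectrum k) _ _)
    refine ⟨z, ?_⟩
    change (snd C U).left z ∈ V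
    have hz : (snd C U).left z = pt u := hz
    rwa [hz]
  have : LocallyOfFiniteType (C ⊗ U).hom :=
    inferInstanceAs (LocallyOfFiniteType (Limits.pullback.fst C.hom U.hom ≫ C.hom))
  have : LocallyOfFiniteType (H.left ≫ A.hom) := by rw [Over.w]; infer_instance
  ext1
  refine ext_of_apply_eq A.hom _ ((snd C U).left ⁻¹ᵁ V).isOpen.isLocallyClosed
    (((snd C U).left ⁻¹ᵁ V).isOpen.dense hne) (fun x hxV hx ↦ ?_) (by rw [Over.w, Over.w])
  have hy : IsClosed {(snd C U).left x} := by simpa using (snd C U).left.isClosedMap _ hx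
  obtain ⟨y, hy⟩ := exists_pt_eq hy
  let l : C ⟶ C ⊗ U := lift (𝟙 C) (toUnit C ≫ y)
  have hl1 : l ≫ fst _ _ = 𝟙 C := lift_fst ..
  have hl2 : l ≫ snd _ _ = toUnit C ≫ y := lift_snd ..
  let h : C ⟶ A := l ≫ H
  have hh (c : C.left) : h.left c ∈ W := by
    refine hVW (l.left c) ?_
    rw [← comp_left_apply, hl2, comp_left_apply, left_apply_eq_pt, hy]
    exact hxV
  let h' := IsOpenImmersion.lift W.ι h.left (by rintro _ ⟨c, rfl⟩; simpa using hh c)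
  have hh' : h' ≫ W.ι = h.left := IsOpenImmersion.lift_fac ..
  have hconst (c d : C.left) : h.left c = h.left d := by
    rw [← hh', Scheme.Hom.comp_apply, Scheme.Hom.comp_apply,
      apply_eq_apply_of_universallyClosed C.hom h' c d]
  have hx' : x ∈ Set.range (C ◁ y).left :=
    (range_whiskerLeft_left y).ge ⟨IsLocalRing.closedPoint k, hy⟩
  obtain ⟨q, rfl⟩ := hx'
  have h1 : C ◁ y = fst _ _ ≫ l := by
    refine CartesianMonoidalCategory.hom_ext _ _ ?_ ?_
    · rw [whiskerLeft_fst, Category.assoc, hl1, Category.comp_id]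
    · rw [whiskerLeft_snd, Category.assoc, hl2, ← Category.assoc]
      congr 1
      exact toUnit_unique _ _
  have h2 : C ◁ y ≫ lift (toUnit _ ≫ c₀) (snd C U) =
      toUnit _ ≫ c₀ ≫ l := by
    refine CartesianMonoidalCategory.hom_ext _ _ ?_ ?_
    · rw [Category.assoc, lift_fst, Category.assoc, Category.assoc, hl1, Category.comp_id,
        ← Category.assoc]
      congr 1
      exact toUnit_unique _ _
    · rw [Category.assoc, lift_snd, Category.assoc, Category.assoc, hl2, whiskerLeft_snd,
        ← Category.assoc, ← Category.assoc]
      congr 1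
      exact toUnit_unique _ _
  rw [← comp_left_apply, ← comp_left_apply, reassoc_of% h2, h1, Category.assoc, comp_left_apply,
    comp_left_apply, comp_left_apply]
  exact hconst _ _

end AlgebraicGeometry

/-! ### Maps that are trivial on both axes. -/

namespace AlgebraicGeometry

open MonoidalCategory CartesianMonoidalCategory MonObj

variable {k : Type u} [Field k]

theorem exists_point [IsAlgClosed k] (U : Over (Spec (.of k))) [LocallyOfFiniteType U.hom]
    [Nonempty U.left] : Nonempty (𝟙_ (Over (Spec (.of k))) ⟶ U) := by
  have : JacobsonSpace U.left := LocallyOfFiniteType.jacobsonSpace U.hom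
  obtain ⟨x, -, hx⟩ := nonempty_inter_closedPoints (X := U.left) Set.univ_nonempty
    isOpen_univ.isLocallyClosed
  exact ⟨(exists_pt_eq hx).choose⟩

theorem eq_of_whiskerLeft_comp_eq [IsAlgClosed k] {D U Y A : Over (Spec (.of k))}
    [IsIntegral (D ⊗ Y).left] [Nonempty D.left] [Nonempty U.left] (u : U ⟶ Y)
    [IsOpenImmersion u.left] [IsSeparated A.hom] {F G : D ⊗ Y ⟶ A} (h : D ◁ u ≫ F = D ◁ u ≫ G) :
    F = G := by
  have hdom : IsDominant (D ◁ u).left := by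
    have : IsOpenImmersion (D ◁ u).left := by
      rw [Over.whiskerLeft_left]
      infer_instance
    refine ⟨(D ◁ u).left.opensRange.isOpen.dense ?_⟩
    obtain ⟨z, -⟩ := Scheme.Pullback.exists_preimage_pullback (f := D.hom) (g := U.hom)
      (Classical.arbitrary D.left) (Classical.arbitrary U.left)
      (Subsingleton.elim (α := PrimeSpectrum k) _ _)
    exact ⟨_, ⟨z, rfl⟩⟩
  ext1
  exact ext_of_isDominant_of_isSeparated A.hom (by rw [Over.w, Over.w]) (D ◁ u).left
    (by rw [← Over.comp_left, h, Over.comp_left])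

/-- Divide the extension `F'` by its slice `E` at a point `u₀` of `U`. The quotient is trivial on `C
× {u₀}`, so by rigidity it depends only on `U`, and at `c₀` it is trivial. -/
theorem eq_one_of_curve [IsAlgClosed k] {C D Y A : Over (Spec (.of k))}
    [LocallyOfFiniteType C.hom] [LocallyOfFiniteType Y.hom] [IsIntegral C.left] [IsIntegral Y.left]
    [UniversallyClosed C.hom] [GrpObj A] [IsProper A.hom] (j : D ⟶ C) [IsOpenImmersion j.left]
    (hC : ∀ c : C.left,
      (∀ U : C.left.Opens, (U : Set C.left).Nonempty → c ∈ U) ∨ HasUniformizerAt C.hom c)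
    (F : D ⊗ Y ⟶ A) (c₀ : 𝟙_ _ ⟶ D) (y₁ : 𝟙_ _ ⟶ Y)
    (hc₀ : lift (toUnit Y ≫ c₀) (𝟙 Y) ≫ F = 1) (hy₁ : lift (𝟙 D) (toUnit D ≫ y₁) ≫ F = 1) :
    F = 1 := by
  have hD : Nonempty D.left := ⟨pt c₀⟩
  obtain ⟨U, u, F', hu, hU, hF'⟩ := exists_extension_of_hasUniformizerAt j hC F
  have hDint : IsIntegral D.left := isIntegral_of_isOpenImmersion j.left
  have hUint : IsIntegral U.left := isIntegral_of_isOpenImmersion u.left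
  have : LocallyOfFiniteType D.hom := by rw [← Over.w j]; infer_instance
  have : LocallyOfFiniteType U.hom := by rw [← Over.w u]; infer_instance
  have hDY : IsIntegral (D ⊗ Y).left := isIntegral_tensorObj D Y
  obtain ⟨u₀⟩ := exists_point U
  let E : C ⟶ A := lift (𝟙 C) (toUnit C ≫ u₀) ≫ F'
  have key : F' * (fst C U ≫ E)⁻¹ = 1 := by
    have h1 : C ◁ u₀ ≫ (F' * (fst C U ≫ E)⁻¹) = toUnit _ ≫ η[A] := by
      have : C ◁ u₀ = fst _ _ ≫ lift (𝟙 C) (toUnit C ≫ u₀) := by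
        rw [comp_lift, Category.comp_id, ← Category.assoc, toUnit_unique (fst _ _ ≫ toUnit C) (snd _ _)]
        refine CartesianMonoidalCategory.hom_ext _ _ ?_ ?_ <;> simp
      rw [comp_mul, GrpObj.comp_inv, whiskerLeft_fst_assoc, this, Category.assoc, mul_inv_cancel,
        Hom.one_def]
    rw [eq_comp_of_whiskerLeft_eq _ u₀ η[A] h1 (c₀ ≫ j), comp_mul, GrpObj.comp_inv]
    have h2 {T : Over (Spec (.of k))} (t : T ⟶ U) :
        lift (toUnit T ≫ c₀ ≫ j) t ≫ F' = 1 := by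
      have : lift (toUnit T ≫ c₀ ≫ j) t =
          t ≫ lift (toUnit U ≫ c₀) (𝟙 U) ≫ j ▷ U := by
        rw [lift_whiskerRight, comp_lift, Category.comp_id, ← Category.assoc, ← Category.assoc,
          ← Category.assoc, toUnit_unique (t ≫ toUnit U) (toUnit T)]
      rw [this, Category.assoc, Category.assoc, hF']
      have : lift (toUnit U ≫ c₀) (𝟙 U) ≫ D ◁ u = u ≫ lift (toUnit Y ≫ c₀) (𝟙 Y) := by
        rw [lift_whiskerLeft, comp_lift, Category.comp_id, Category.id_comp, ← Category.assoc,
          toUnit_unique (u ≫ toUnit Y) (toUnit U)]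
      rw [reassoc_of% this, hc₀, comp_one, comp_one]
    have h3 : lift (toUnit (C ⊗ U) ≫ c₀ ≫ j) (snd C U) ≫ fst C U ≫ E = 1 := by
      have : (c₀ ≫ j) ≫ lift (𝟙 C) (toUnit C ≫ u₀) = lift (toUnit _ ≫ c₀ ≫ j) u₀ := by
        rw [comp_lift, Category.comp_id, ← Category.assoc,
          toUnit_unique ((c₀ ≫ j) ≫ toUnit C) (𝟙 _), toUnit_unique (toUnit (𝟙_ _)) (𝟙 _),
          Category.id_comp, Category.id_comp]
      have hE : (c₀ ≫ j) ≫ E = 1 := by rw [← Category.assoc, this, h2]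
      rw [lift_fst_assoc, Category.assoc, hE, comp_one]
    rw [h2, h3, inv_one, _root_.mul_one]
  have hF'E : F' = fst C U ≫ E := by rwa [mul_inv_eq_one] at key
  -- The point `y₁` need not lie in `U`, so the formula is first carried by density from `D × U` to
  -- `D × Y`, where it can be evaluated at `y₁`.
  have hFE : F = fst D Y ≫ j ≫ E := by
    refine eq_of_whiskerLeft_comp_eq u ?_
    rw [← hF', hF'E, whiskerLeft_fst_assoc, whiskerRight_fst_assoc]
  have hjE : j ≫ E = 1 := by
    rwa [hFE, lift_fst_assoc, Category.id_comp] at hy₁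
  rw [hFE, hjE, comp_one]

theorem eq_one_of_lift_eq_one [IsAlgClosed k] {X Y A : Over (Spec (.of k))}
    [LocallyOfFiniteType X.hom] [LocallyOfFiniteType Y.hom] [IsIntegral X.left] [IsIntegral Y.left]
    [GrpObj A] [IsProper A.hom] (ψ : X ⊗ Y ⟶ A) (x₀ : 𝟙_ _ ⟶ X) (y₁ : 𝟙_ _ ⟶ Y)
    (hx₀ : lift (toUnit Y ≫ x₀) (𝟙 Y) ≫ ψ = 1) (hy₁ : lift (𝟙 X) (toUnit X ≫ y₁) ≫ ψ = 1) :
    ψ = 1 := by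
  have hP : IsIntegral (X ⊗ Y).left := isIntegral_tensorObj X Y
  have : LocallyOfFiniteType (X ⊗ Y).hom :=
    inferInstanceAs (LocallyOfFiniteType (Limits.pullback.fst X.hom Y.hom ≫ X.hom))
  have : LocallyOfFiniteType (ψ.left ≫ A.hom) := by rw [Over.w]; infer_instance
  ext1
  refine ext_of_apply_eq A.hom Set.univ isOpen_univ.isLocallyClosed dense_univ
    (fun p _ hp ↦ ?_) (by rw [Over.w, Over.w])
  obtain ⟨p, rfl⟩ := exists_pt_eq hp
  rw [Hom.one_def, comp_left_apply, left_apply_eq_pt]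
  let y := p ≫ snd X Y
  let s : X ⟶ A := lift (𝟙 X) (toUnit X ≫ y) ≫ ψ
  -- The points where the slice at `y` takes the value of the unit. It contains `x₀`; were it
  -- proper, a curve through `x₀` leaving it would contradict the case of curves.
  let Z : Set X.left := s.left ⁻¹' {pt η[A]}
  have hZ : IsClosed Z := (isClosed_pt η[A]).preimage s.left.continuous
  have hps : p ≫ ψ = (p ≫ fst X Y) ≫ s := by
    have : p = (p ≫ fst X Y) ≫ lift (𝟙 X) (toUnit X ≫ y) := by
      rw [comp_lift, Category.comp_id, ← Category.assoc, toUnit_unique (_ ≫ toUnit X) (𝟙 _),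
        Category.id_comp]
      exact (lift_comp_fst_snd p).symm
    nth_rw 1 [this]
    rw [Category.assoc]
  change (p ≫ ψ).left _ = _
  rw [hps]
  change (p ≫ fst X Y).left _ ∈ Z
  by_cases hZ' : Z = Set.univ
  · rw [hZ']; trivial
  exfalso
  have hx₀Z : pt x₀ ∈ Z := by
    have : x₀ ≫ s = η[A] := by
      have (y : 𝟙_ _ ⟶ Y) :
          x₀ ≫ lift (𝟙 X) (toUnit X ≫ y) = y ≫ lift (toUnit Y ≫ x₀) (𝟙 Y) := by
        rw [comp_lift, comp_lift, Category.comp_id, Category.comp_id, ← Category.assoc,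
          ← Category.assoc, toUnit_unique (x₀ ≫ toUnit X) (𝟙 _), toUnit_unique (y ≫ toUnit Y) (𝟙 _),
          Category.id_comp, Category.id_comp]
      rw [← Category.assoc, this, Category.assoc, hx₀, comp_one, one_eq_one]
    change (x₀ ≫ s).left _ = _
    rw [this]
    rfl
  obtain ⟨C, D, j, f, c₀, _, _, _, _, hf, hfZ, hC⟩ := exists_curve x₀ hZ hZ' hx₀Z
  have hF : f ▷ Y ≫ ψ = 1 := by
    refine eq_one_of_curve j hC _ c₀ y₁ ?_ ?_
    · rw [lift_whiskerRight_assoc, Category.assoc, hf, hx₀]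
    · have : lift (𝟙 D) (toUnit D ≫ y₁) ≫ f ▷ Y = f ≫ lift (𝟙 X) (toUnit X ≫ y₁) := by
        rw [lift_whiskerRight, comp_lift, Category.comp_id, Category.id_comp, ← Category.assoc,
          toUnit_unique (f ≫ toUnit X) (toUnit D)]
      rw [reassoc_of% this, hy₁, comp_one]
  apply hfZ
  rintro _ ⟨d, rfl⟩
  have : f ≫ s = 1 := by
    have : f ≫ lift (𝟙 X) (toUnit X ≫ y) = lift (𝟙 D) (toUnit D ≫ y) ≫ f ▷ Y := by
      rw [lift_whiskerRight, comp_lift, Category.comp_id, Category.id_comp, ← Category.assoc,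
        toUnit_unique (f ≫ toUnit X) (toUnit D)]
    rw [← Category.assoc, this, Category.assoc, hF, comp_one]
  change (f ≫ s).left d = _
  rw [this, Hom.one_def, comp_left_apply, left_apply_eq_pt]

end AlgebraicGeometry

/-! ### The homomorphism property over an algebraically closed field. -/

namespace AlgebraicGeometry

open MonoidalCategory CartesianMonoidalCategory MonObj

variable {k : Type u} [Field k]

theorem mul_comp_eq_of_isAlgClosed [IsAlgClosed k] {G A : Over (Spec (.of k))}
    [GrpObj G] [LocallyOfFiniteType G.hom] [IsIntegral G.left] [GrpObj A] [IsProper A.hom]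
    (φ : G ⟶ A) (hφ : η[G] ≫ φ = η[A]) : μ[G] ≫ φ = (fst G G ≫ φ) * (snd G G ≫ φ) := by
  have h₀ : lift (toUnit G ≫ η[G]) (𝟙 G) ≫ μ[G] = 𝟙 G := by
    rw [← Hom.mul_def, ← Hom.one_def, _root_.one_mul]
  have h₁ : lift (𝟙 G) (toUnit G ≫ η[G]) ≫ μ[G] = 𝟙 G := by
    rw [← Hom.mul_def, ← Hom.one_def, _root_.mul_one]
  -- The order of the inverses matters, since `A` need not be commutative: cancelling them yields
  -- `φ(g) φ(h)` in this order.
  have key := eq_one_of_lift_eq_one ((μ[G] ≫ φ) * (snd G G ≫ φ)⁻¹ * (fst G G ≫ φ)⁻¹) η[G] η[G]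
    (by
      rw [comp_mul, comp_mul, GrpObj.comp_inv, GrpObj.comp_inv, reassoc_of% h₀, lift_fst_assoc,
        lift_snd_assoc, Category.id_comp, mul_inv_cancel, Category.assoc, hφ, ← Hom.one_def,
        inv_one, _root_.one_mul])
    (by
      rw [comp_mul, comp_mul, GrpObj.comp_inv, GrpObj.comp_inv, reassoc_of% h₁, lift_fst_assoc,
        lift_snd_assoc, Category.id_comp, Category.assoc, hφ, ← Hom.one_def, inv_one,
        _root_.mul_one, mul_inv_cancel])
  rwa [mul_inv_eq_one, mul_inv_eq_iff_eq_mul] at key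

end AlgebraicGeometry

/-! ### Integrality and geometric connectedness of the group. -/

/-- The closure of an irreducible open `U` is open: an irreducible open neighbourhood of a point of
the closure meets `U`, so it lies in the closure. -/
theorem irreducibleSpace_of_isOpenCover {X : Type*} [TopologicalSpace X] [ConnectedSpace X]
    (h : ∀ x : X, ∃ U : Set X, IsOpen U ∧ x ∈ U ∧ IsIrreducible U) : IrreducibleSpace X := by
  obtain ⟨U, hU, hxU, hUirr⟩ := h (Classical.arbitrary X)
  have hop : IsOpen (closure U) := by
    refine isOpen_iff_forall_mem_open.mpr fun z hz ↦ ?_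
    obtain ⟨V, hV, hzV, hVirr⟩ := h z
    refine ⟨V, ?_, hV, hzV⟩
    exact (subset_closure_inter_of_isPreirreducible_of_isOpen hVirr.2 hU
      (mem_closure_iff.mp hz V hV hzV)).trans (closure_mono Set.inter_subset_right)
  have huniv : closure U = Set.univ :=
    IsClopen.eq_univ ⟨isClosed_closure, hop⟩ ⟨_, subset_closure hxU⟩
  have : IsIrreducible (Set.univ : Set X) := huniv ▸ hUirr.closure
  have : PreirreducibleSpace X := ⟨this.2⟩
  exact ⟨inferInstance⟩

/-- Remove from the space all irreducible components but one. -/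
theorem exists_isOpen_isIrreducible (X : Type*) [TopologicalSpace X]
    [TopologicalSpace.NoetherianSpace X] [Nonempty X] :
    ∃ U : Set X, IsOpen U ∧ IsIrreducible U := by
  have hZ := irreducibleComponent_mem_irreducibleComponents (Classical.arbitrary X)
  have hfin := TopologicalSpace.NoetherianSpace.finite_irreducibleComponents (α := X)
  refine ⟨(⋃₀ (irreducibleComponents X \ {irreducibleComponent (Classical.arbitrary X)}))ᶜ, ?_, ?_⟩
  · rw [Set.sUnion_eq_biUnion]
    exact ((hfin.subset Set.sdiff_subset).isClosed_biUnion fun s hs ↦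
      isClosed_of_mem_irreducibleComponents s hs.1).isOpen_compl
  · rw [← isIrreducible_iff_closure, closure_sUnion_irreducibleComponents_sdiff_singleton hfin _ hZ]
    exact hZ.1

namespace AlgebraicGeometry

open MonoidalCategory CartesianMonoidalCategory MonObj Limits

variable {k : Type u} [Field k]

theorem isReduced_of_smooth {X : Scheme.{u}} (f : X ⟶ Spec (.of k)) [Smooth f] : IsReduced X := by
  have (x : X) : ∃ V : X.Opens, x ∈ V ∧ IsReduced V := by
    obtain ⟨U, hU, V, hV, hx, e, h⟩ := Smooth.exists_isStandardSmooth f x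
    refine ⟨V, hx, ?_⟩
    have : Nonempty U := ⟨f x, e hx⟩
    have := h.isReduced
    exact isReduced_of_isOpenImmersion hV.isoSpec.hom
  choose V hxV hV using this
  refine @IsReduced.of_openCover _ (X.openCoverOfIsOpenCover V
    (.mk (by rw [eq_top_iff]; exact fun x _ ↦ TopologicalSpace.Opens.mem_iSup.mpr ⟨x, hxV x⟩))) hV

/-- Translations carry one irreducible open set to a neighbourhood of any closed point. The union of
all irreducible opens then contains every closed point, hence is everything, and connectedness
concludes. -/
theorem irreducibleSpace_of_grpObj_of_isAlgClosed [IsAlgClosed k] (G : Over (Spec (.of k)))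
    [GrpObj G] [LocallyOfFiniteType G.hom] [QuasiCompact G.hom] [ConnectedSpace G.left] :
    IrreducibleSpace G.left := by
  have : JacobsonSpace G.left := LocallyOfFiniteType.jacobsonSpace G.hom
  have : IsLocallyNoetherian G.left := LocallyOfFiniteType.isLocallyNoetherian G.hom
  have : CompactSpace G.left := QuasiCompact.compactSpace_of_compactSpace G.hom
  have : IsNoetherian G.left := {}
  obtain ⟨U, hU, hUirr⟩ := exists_isOpen_isIrreducible G.left
  obtain ⟨y, hyU, hy⟩ := nonempty_inter_closedPoints hUirr.1 hU.isLocallyClosed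
  obtain ⟨y, rfl⟩ := exists_pt_eq hy
  have key (x : 𝟙_ (Over (Spec (.of k))) ⟶ G) :
      ∃ U : Set G.left, IsOpen U ∧ pt x ∈ U ∧ IsIrreducible U := by
    let α := (GrpObj.mulRight x).symm ≪≫ GrpObj.mulRight y
    have hα : x ≫ α.hom = y := by
      have h (z : 𝟙_ _ ⟶ G) : η[G] ≫ (GrpObj.mulRight z).hom = z := by
        rw [GrpObj.mulRight_hom, comp_lift_assoc, Category.comp_id, ← Category.assoc,
          toUnit_unique (η ≫ toUnit _) (𝟙 _), Category.id_comp, ← Hom.mul_def, one_eq_one,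
          _root_.one_mul]
      have h' : x ≫ (GrpObj.mulRight x).inv = η[G] := by rw [Iso.comp_inv_eq, h]
      change x ≫ (GrpObj.mulRight x).inv ≫ (GrpObj.mulRight y).hom = y
      rw [reassoc_of% h', h]
    let e : G.left ≅ G.left := (Over.forget _).mapIso α
    refine ⟨e.hom ⁻¹' U, hU.preimage e.hom.continuous, ?_, ?_⟩
    · change (x ≫ α.hom).left _ ∈ U
      rw [hα]
      exact hyU
    · have : e.hom ⁻¹' U = e.inv '' U := by
        exact (congrFun (Scheme.homeoOfIso e).image_symm U).symm
      rw [this]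
      exact hUirr.image _ e.inv.continuous.continuousOn
  refine irreducibleSpace_of_isOpenCover fun x ↦ ?_
  let W : Set G.left := ⋃₀ {U | IsOpen U ∧ IsIrreducible U}
  have hW : IsOpen W := isOpen_sUnion fun U hU ↦ hU.1
  have hWuniv : W = Set.univ := by
    rw [← Set.compl_empty_iff, ← Set.not_nonempty_iff_eq_empty]
    intro hne
    obtain ⟨x, hxW, hx⟩ := nonempty_inter_closedPoints hne hW.isClosed_compl.isLocallyClosed
    obtain ⟨x, rfl⟩ := exists_pt_eq hx
    obtain ⟨V, hV, hxV, hVirr⟩ := key x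
    exact hxW ⟨V, ⟨hV, hVirr⟩, hxV⟩
  obtain ⟨V, ⟨hV, hVirr⟩, hxV⟩ := hWuniv.ge (Set.mem_univ x)
  exact ⟨V, hV, hxV, hVirr⟩

/-- A connected scheme over a field which has a rational point stays connected over any algebraic
extension. -/
theorem connectedSpace_pullback_of_section {K : Type u} [Field K] [Algebra k K]
    [Algebra.IsAlgebraic k K] {X : Scheme.{u}} (f : X ⟶ Spec (.of k)) [ConnectedSpace X]
    (s : Spec (.of k) ⟶ X) (hs : s ≫ f = 𝟙 _) :
    ConnectedSpace ↥(pullback f (Spec.map (CommRingCat.ofHom (algebraMap k K)))) := by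
  let g := Spec.map (CommRingCat.ofHom (algebraMap k K))
  let p := pullback.fst f g
  have : IsIntegralHom g := by
    rw [IsIntegralHom.SpecMap_iff]
    exact algebraMap_isIntegral_iff.mpr inferInstance
  have hopen : IsOpenMap p := p.isOpenMap
  have hclosed : IsClosedMap p := p.isClosedMap
  -- The fibre of `p` over the rational point is `Spec K`, a single point. Since `p` is open and
  -- closed, every nonempty clopen set surjects onto `X` and so contains that point; two
  -- complementary ones cannot.
  have : Subsingleton ↥(pullback s p) := by
    let e : pullback s p ≅ Spec (.of K) :=
      pullbackRightPullbackFstIso f g s ≪≫ pullback.congrHom hs rfl ≪≫ asIso (pullback.snd _ _)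
    have : Subsingleton (Spec (.of K)) := inferInstanceAs (Subsingleton (PrimeSpectrum K))
    exact (Scheme.homeoOfIso e).injective.subsingleton
  let o : Spec (.of k) := IsLocalRing.closedPoint k
  have hfib (x y : ↥(pullback f g)) (hx : p x = s o) (hy : p y = s o) : x = y := by
    obtain ⟨x, -, rfl⟩ := Scheme.Pullback.exists_preimage_pullback o x hx.symm
    obtain ⟨y, -, rfl⟩ := Scheme.Pullback.exists_preimage_pullback o y hy.symm
    rw [Subsingleton.elim x y]
  have hmem {U : Set ↥(pullback f g)} (hU : IsClopen U) (hne : U.Nonempty) : ∃ x ∈ U, p x = s o := by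
    have := IsClopen.eq_univ ⟨hclosed _ hU.1, hopen _ hU.2⟩ (hne.image p)
    exact this.ge (Set.mem_univ (s o))
  have : Nonempty ↥(pullback f g) := by
    obtain ⟨z, -⟩ := Scheme.Pullback.exists_preimage_pullback (f := f) (g := g) (s o)
      (Classical.arbitrary _) (Subsingleton.elim (α := PrimeSpectrum k) _ _)
    exact ⟨z⟩
  rw [connectedSpace_iff_clopen]
  refine ⟨this, fun U hU ↦ ?_⟩
  by_contra! h
  obtain ⟨x, hxU, hx⟩ := hmem hU h.1
  obtain ⟨y, hyU, hy⟩ := hmem hU.compl (Set.nonempty_compl.mpr h.2)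
  exact hyU (hfib x y hx hy ▸ hxU)

end AlgebraicGeometry

/-! ### Descent from the algebraic closure. -/

namespace AlgebraicGeometry

open MonoidalCategory CartesianMonoidalCategory MonObj Limits

variable {k : Type u} [Field k]

theorem mul_comp_eq_of_faithful {C D : Type*} [Category* C] [Category* D]
    [CartesianMonoidalCategory C] [CartesianMonoidalCategory D] (F : C ⥤ D) [F.Monoidal]
    [F.Faithful] {G A : C} [GrpObj G] [GrpObj A] (φ : G ⟶ A)
    (h : letI : GrpObj (F.obj G) := Functor.grpObjObj
      letI : GrpObj (F.obj A) := Functor.grpObjObj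
      μ[F.obj G] ≫ F.map φ = (fst _ _ ≫ F.map φ) * (snd _ _ ≫ F.map φ)) :
    μ[G] ≫ φ = (fst G G ≫ φ) * (snd G G ≫ φ) := by
  let : GrpObj (F.obj A) := Functor.grpObjObj
  apply F.map_injective
  rw [← cancel_epi (Functor.Monoidal.μIso F G G).hom, Functor.map_mul, F.map_comp, F.map_comp,
    F.map_comp, comp_mul, Functor.Monoidal.μIso_hom]
  simp only [← Category.assoc]
  rw [Functor.Monoidal.μ_fst, Functor.Monoidal.μ_snd]
  exact h

theorem mul_comp_eq_of_isProper (G A : Over (Spec (.of k)))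
    [GrpObj G] [Smooth G.hom] [QuasiCompact G.hom] [ConnectedSpace G.left]
    [GrpObj A] [IsProper A.hom] (φ : G ⟶ A) (hφ : η[G] ≫ φ = η[A]) :
    μ[G] ≫ φ = (fst G G ≫ φ) * (snd G G ≫ φ) := by
  let f := Spec.map (CommRingCat.ofHom <| algebraMap k (AlgebraicClosure k))
  let F := Over.pullback f
  refine mul_comp_eq_of_faithful F φ ?_
  let : GrpObj (F.obj G) := Functor.grpObjObj
  let : GrpObj (F.obj A) := Functor.grpObjObj
  have : IsProper (F.obj A).hom := inferInstanceAs (IsProper (pullback.snd A.hom f))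
  have : Smooth (F.obj G).hom := inferInstanceAs (Smooth (pullback.snd G.hom f))
  have : QuasiCompact (F.obj G).hom := inferInstanceAs (QuasiCompact (pullback.snd G.hom f))
  have : ConnectedSpace (F.obj G).left :=
    connectedSpace_pullback_of_section G.hom η[G].left (Over.w η[G])
  have : IsReduced (F.obj G).left := isReduced_of_smooth (F.obj G).hom
  have : IrreducibleSpace (F.obj G).left := irreducibleSpace_of_grpObj_of_isAlgClosed _
  have : IsIntegral (F.obj G).left := isIntegral_of_irreducibleSpace_of_isReduced _
  refine mul_comp_eq_of_isAlgClosed (F.map φ) ?_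
  change (Functor.LaxMonoidal.ε F ≫ F.map η[G]) ≫ F.map φ = Functor.LaxMonoidal.ε F ≫ F.map η[A]
  rw [Category.assoc, ← F.map_comp, hφ]

end AlgebraicGeometry

/-- Let `k` be a field, `G` a connected smooth algebraic group over `k` (a group object in
`k`-schemes that is smooth and of finite type over `k`, with connected underlying space), and `A` a
proper algebraic group over `k` (a group object in `k`-schemes, proper over `k`). Every morphism of
`k`-schemes `φ : G ⟶ A` that sends the unit section of `G` to the unit section of `A` is a
homomorphism of group schemes. -/
theorem mainTheorem6 {k : Type u} [Field k]
    (G A : Over (Spec (CommRingCat.of k)))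
    [GrpObj G] [Smooth G.hom] [QuasiCompact G.hom] [ConnectedSpace G.left]
    [GrpObj A] [IsProper A.hom]
    (φ : G ⟶ A) (hφ : η[G] ≫ φ = η[A]) :
    IsMonHom φ where
  one_hom := hφ
  mul_hom := by
    rw [mul_comp_eq_of_isProper G A φ hφ, Hom.mul_def]
    congr 1
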